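/- **Model.** Time is slotted. Let $A,S,Q$ be integers with $1\le A\le S$ and $A\le Q$, and let $0<\alpha<1$. A buffer holds $q[n]\in\{0,\dots,Q\}$ packets at the beginning of timeslot $n$. In timeslot $n$, $s[n]\in\{0,\dots,S\}$ packets are transmitted, subject to $0\le q[n]-s[n]\le Q-A$, and then, independently with probability $\alpha$, $A$ packets arrive: $q[n+1]=q[n]-s[n]+A$ with probability $\alpha$ and $q[n+1]=q[n]-s[n]$ with probability $1-\alpha$. Transmitting $s$ packets costs power $P_s$, where $P_0=0$ and $P_s$ is strictly increasing and convex in $s\in\{0,\dots,S\}$. A (feasible) policy $\gamma$ chooses $s[n]$ at random, with a distribution that depends on $q[1],s[1],\dots,s[n-1],q[n]$ and is concentrated on the admissible actions. For an initial state $q[1]=q_0$, its average power and average delay are $$P_\gamma=\lim_{N\to\infty}\frac1N\,\mathrm E^{\gamma}_{q_0}\Big\{\sum_{n=1}^N P_{s[n]}\Big\},\qquad D_\gamma=\frac1{\alpha A}\lim_{N\to\infty}\frac1N\,\mathrm E^{\gamma}_{q_0}\Big\{\sum_{n=1}^N q[n]\Big\}.$$ Let $\mathcal R$ be the set of the points $(P_\gamma,D_\gamma)$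 for all policies $\gamma$ for which both limits exist, and let the optimal delay-power tradeoff curve be $$\mathcal L=\{(P,D)\in\mathcal R:\ \text{for all }(P',D')\in\mathcal R,\ P'\ge P\text{ or }D'\ge D\}.$$ A deterministic policy transmits, in each state $q$, a fixed admissible number $s(q)$ of packets; it *obtains* a point $Z$ of the plane if $(P_\gamma,D_\gamma)=Z$ for every initial state. **Corollary 3.** The curve $\mathcal L$ is decreasing (if $(P_1,D_1),(P_2,D_2)\in\mathcal L$ and $P_1<P_2$, then $D_1>D_2$), convex (the set $\{(P,D): (P,D')\in\mathcal L\text{ for some }D'\le D\}$ is convex), and piecewise linear, and it does not depend on $q_0$. More precisely, there are $n\ge 0$ and points $Z_0,\dots,Z_n$, called the vertices, with strictly increasing delays and nonincreasing powers, such that $\mathcal L$ is the polygonal chain consisting of the segments $\overline{Z_iZ_{i+1}}$, $0\le i<n$ (the point $Z_0$ if $n=0$), and such that 1. every corner of $\mathcal L$ (every point of $\mathcal L$ that is not in the interior of a nondegenerate line segment contained in $\mathcal L$) is one of the $Z_i$; 2. every vertex $Z_i$ is obtained by a deterministic policy; 3. for every $0\le i<n$, the neighbouring vertices $Z_i$ and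 $Z_{i+1}$ are obtained by deterministic policies that take different actions in exactly one state. (Some vertices may lie in the interior of a straight piece of $\mathcal L$.) -/

import Mathlib

open Filter Topology

/-- The parameters of the buffer-aware scheduling model, with the standing assumptions on them.
Each arrival brings `A` packets and occurs in a timeslot with probability `α`; at most `S` packets
are transmitted per timeslot, the buffer holds at most `Q` packets, and transmitting `s` packets
costs power `P s` (only the values `P 0, …, P S` are relevant). -/
structure BufferModel where
  A : ℕ
  S : ℕ
  Q : ℕ
  α : ℝ
  P : ℕ → ℝ
  one_le_A : 1 ≤ A
  A_le_S : A ≤ S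
  A_le_Q : A ≤ Q
  α_pos : 0 < α
  α_lt_one : α < 1
  P_zero : P 0 = 0
  P_strictMono : ∀ s, s + 1 ≤ S → P s < P (s + 1)
  P_convex : ∀ s, s + 2 ≤ S → P (s + 1) - P s ≤ P (s + 2) - P (s + 1)

namespace BufferModel

/-- Buffer states `0, …, Q`. -/
abbrev State (M : BufferModel) : Type := Fin (M.Q + 1)

/-- Actions: the number `0, …, S` of transmitted packets. -/
abbrev Action (M : BufferModel) : Type := Fin (M.S + 1)

/-- No underflow and no overflow: `0 ≤ q - s ≤ Q - A`. -/
def Allowed (M : BufferModel) (q : M.State) (s : M.Action) : Prop :=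
  (s : ℕ) ≤ (q : ℕ) ∧ (q : ℕ) + M.A ≤ M.Q + (s : ℕ)

/-- Transition probability `Pr{q[n+1] = j | q[n] = q, s[n] = s}`: it is `α` if `j = q - s + A`,
`1 - α` if `j = q - s`, and `0` otherwise. -/
noncomputable def trans (M : BufferModel) (q : M.State) (s : M.Action) (j : M.State) : ℝ :=
  if (j : ℕ) + (s : ℕ) = (q : ℕ) + M.A then M.α
  else if (j : ℕ) + (s : ℕ) = (q : ℕ) then 1 - M.α
  else 0

/-- A feasible (randomized, history-dependent) transmission policy. `rule h q s` is the conditional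
probability of transmitting `s` packets when the current state is `q` and the earlier states and
actions are listed, most recent first, in `h`; the length of `h` determines the timeslot. -/
structure Policy (M : BufferModel) where
  rule : List (M.State × M.Action) → M.State → M.Action → ℝ
  nonneg : ∀ h q s, 0 ≤ rule h q s
  sum_eq_one : ∀ h q, ∑ s, rule h q s = 1
  feasible : ∀ h q s, ¬ M.Allowed q s → rule h q s = 0

/-- A feasible stationary deterministic policy: it transmits `act q` packets in state `q`. -/
structure DetPolicy (M : BufferModel) where
  act : M.State → M.Action
  allowed : ∀ q, M.Allowed q (act q)

/-- A deterministic policy, as a policy. -/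
def DetPolicy.toPolicy {M : BufferModel} (F : M.DetPolicy) : M.Policy where
  rule := fun _ q s => if s = F.act q then 1 else 0
  nonneg := by
    intro h q s
    split_ifs
    · exact zero_le_one
    · exact le_refl 0
  sum_eq_one := by
    intro h q
    simp
  feasible := by
    intro h q s hs
    have hne : s ≠ F.act q := by
      rintro rfl
      exact hs (F.allowed q)
    simp [hne]

/-- Two deterministic policies take different actions in exactly one state. -/
def DetPolicy.DifferInOneState {M : BufferModel} (F F' : M.DetPolicy) : Prop :=
  ∃ q, F.act q ≠ F'.act q ∧ ∀ q', q' ≠ q → F.act q' = F'.act q'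

/-- The probability, under policy `γ` and initial state `q₀`, that the states and actions of the
first timeslots are those listed (most recent first) in the history and that the state after them
is the given one. -/
noncomputable def histProb (M : BufferModel) (γ : M.Policy) (q₀ : M.State) :
    List (M.State × M.Action) → M.State → ℝ
  | [], q => if q = q₀ then 1 else 0
  | (q', s') :: h, q => histProb M γ q₀ h q' * γ.rule h q' s' * M.trans q' s' q

/-- The expectation `E_{q₀}^γ {c(q[k+1], s[k+1])}` of an immediate cost in the timeslot that is
preceded by `k` timeslots. -/
noncomputable def stageMean (M : BufferModel) (γ : M.Policy) (q₀ : M.State)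
    (c : M.State → M.Action → ℝ) (k : ℕ) : ℝ :=
  ∑ h : List.Vector (M.State × M.Action) k, ∑ q : M.State, ∑ s : M.Action,
    M.histProb γ q₀ h.toList q * γ.rule h.toList q s * c q s

/-- The expected time average `(1/N) E_{q₀}^γ {∑_{n=1}^N c(q[n], s[n])}`. -/
noncomputable def timeAverage (M : BufferModel) (γ : M.Policy) (q₀ : M.State)
    (c : M.State → M.Action → ℝ) (N : ℕ) : ℝ :=
  (1 / (N : ℝ)) * ∑ k ∈ Finset.range N, M.stageMean γ q₀ c k

/-- Policy `γ`, started in `q₀`, obtains the point `z = (P_γ, D_γ)` of the delay-power plane: the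
long-run average power exists and is `z.1`; the long-run average queue length, divided by the
arrival rate `α A`, exists and is the average delay `z.2`. -/
def Obtains (M : BufferModel) (γ : M.Policy) (q₀ : M.State) (z : ℝ × ℝ) : Prop :=
  Tendsto (M.timeAverage γ q₀ (fun _ s => M.P (s : ℕ))) atTop (𝓝 z.1) ∧
  Tendsto (fun N => (1 / (M.α * (M.A : ℝ))) * M.timeAverage γ q₀ (fun q _ => ((q : ℕ) : ℝ)) N)
    atTop (𝓝 z.2)

/-- The set of all feasible points in the delay-power plane. -/
def region (M : BufferModel) (q₀ : M.State) : Set (ℝ × ℝ) :=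
  {z | ∃ γ : M.Policy, M.Obtains γ q₀ z}

/-- The optimal delay-power tradeoff curve: the feasible points `(P, D)` such that every feasible
`(P', D')` has `P' ≥ P` or `D' ≥ D`. -/
def tradeoffCurve (M : BufferModel) (q₀ : M.State) : Set (ℝ × ℝ) :=
  {z | z ∈ M.region q₀ ∧ ∀ z' ∈ M.region q₀, z.1 ≤ z'.1 ∨ z.2 ≤ z'.2}

end BufferModel

/-- The polygonal chain with successive vertices `z 0, …, z n` (a point if `n = 0`). -/
def polygonalChain {n : ℕ} (z : Fin (n + 1) → ℝ × ℝ) : Set (ℝ × ℝ) :=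
  Set.range z ∪ ⋃ i : Fin n, segment ℝ (z i.castSucc) (z i.succ)

/-- The curve `C` in the plane is decreasing. -/
def DecreasingCurve (C : Set (ℝ × ℝ)) : Prop :=
  ∀ z ∈ C, ∀ w ∈ C, z.1 < w.1 → w.2 < z.2

/-- The curve `C` in the plane is convex: the set of points lying on or above it is convex. -/
def ConvexCurve (C : Set (ℝ × ℝ)) : Prop :=
  Convex ℝ {z : ℝ × ℝ | ∃ w ∈ C, w.1 = z.1 ∧ w.2 ≤ z.2}

/-- `v` is a corner of `C`: a point of `C` that is not in the interior of a nondegenerate line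
segment contained in `C`. -/
def IsCurveCorner (C : Set (ℝ × ℝ)) (v : ℝ × ℝ) : Prop :=
  v ∈ C ∧ ∀ a b : ℝ × ℝ, segment ℝ a b ⊆ C → v ∈ openSegment ℝ a b → a = b

/-!
Vanishing discount gives, for each weight `μ` of the delay, a solution of the average-cost
optimality equation whose bias is convex in the queue length. Convexity makes the least and the
greatest optimal numbers of packets left in the buffer nondecreasing in the queue length, with
increments at most one. Such monotone policies have at most one closed class of communicating
states, so their averages do not depend on the initial state, and their delays are ordered like
their levels. Raising the levels one state at a time from the least to the greatest optimal ones
keeps the policy optimal and therefore walks along a face of the feasible region.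

The feasible region is convex, since policies can be mixed, and it lies in a cone whose apex has
delay one. Gift wrapping from the apex, with the supporting line pivoted about the last vertex of
one face to find the next, reaches the end of the tradeoff curve after finitely many faces.
-/

/-! ### Faces of planar sets -/

theorem exists_fin_sequence_of_reflTransGen {β : Type*} {r : β → β → Prop} {a b : β}
    (h : Relation.ReflTransGen r a b) : ∃ (n : ℕ) (z : Fin (n + 1) → β), z 0 = a ∧
      z (Fin.last n) = b ∧ ∀ i : Fin n, r (z i.castSucc) (z i.succ) := by
  obtain ⟨l, hl, hb⟩ := List.exists_isChain_cons_of_relationReflTransGen h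
  refine ⟨l.length, fun i => (a :: l)[(i : ℕ)], rfl, ?_, fun i => ?_⟩
  · rw [← hb, List.getLast_eq_getElem]
    simp
  · exact hl.getElem i (by simp)

section PolygonalChain

variable {n : ℕ} (z : Fin (n + 1) → ℝ × ℝ)

theorem vertex_mem_polygonalChain (i : Fin (n + 1)) : z i ∈ polygonalChain z :=
  Or.inl ⟨i, rfl⟩

theorem segment_subset_polygonalChain (i : Fin n) :
    segment ℝ (z i.castSucc) (z i.succ) ⊆ polygonalChain z :=
  (Set.subset_iUnion (fun i : Fin n => segment ℝ (z i.castSucc) (z i.succ)) i).trans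
    Set.subset_union_right

theorem isPathConnected_polygonalChain : IsPathConnected (polygonalChain z) := by
  have joined_vertex : ∀ i, JoinedIn (polygonalChain z) (z 0) (z i) := fun i => by
    induction i using Fin.induction with
    | zero => exact .refl (vertex_mem_polygonalChain z 0)
    | succ i ih =>
      exact ih.trans (.of_segment_subset (segment_subset_polygonalChain z i))
  refine ⟨z 0, vertex_mem_polygonalChain z 0, ?_⟩
  rintro v (⟨i, rfl⟩ | hv)
  · exact joined_vertex i
  · obtain ⟨i, hi⟩ := Set.mem_iUnion.1 hv
    exact (joined_vertex i.castSucc).trans (.of_segment_subset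
      (((convex_segment _ _).segment_subset (left_mem_segment ℝ _ _) hi).trans
        (segment_subset_polygonalChain z i)))

theorem convex_image_polygonalChain {f : ℝ × ℝ → ℝ} (hf : Continuous f) :
    Convex ℝ (f '' polygonalChain z) :=
  Real.convex_iff_isPreconnected.2
    ((isPathConnected_polygonalChain z).isConnected.isPreconnected.image f hf.continuousOn)

end PolygonalChain

/-- The weak Pareto front of a planar set `R` whose two coordinates are both to be minimized: the
points that no point of `R` improves strictly in both coordinates. -/
def weakParetoFront (R : Set (ℝ × ℝ)) : Set (ℝ × ℝ) :=
  {z | z ∈ R ∧ ∀ w ∈ R, z.1 ≤ w.1 ∨ z.2 ≤ w.2}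

/-- The point `z` lies on the exposed face of `R` where `w ↦ w.1 + μ * w.2` is least. -/
structure OnFace (R : Set (ℝ × ℝ)) (μ : ℝ) (z : ℝ × ℝ) : Prop where
  mem : z ∈ R
  le : ∀ w ∈ R, z.1 + μ * z.2 ≤ w.1 + μ * w.2

/-- The point `z` has the greatest second coordinate on its face: the corner at which the supporting
line of weight `μ` is pivoted to find the next face. -/
structure IsLastOnFace (R : Set (ℝ × ℝ)) (μ : ℝ) (z : ℝ × ℝ) : Prop extends OnFace R μ z where
  last : ∀ w, OnFace R μ w → w.2 ≤ z.2

/-- The set `R` lies in a cone with apex `a`, bounded by lines of finite slope and opening in the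
direction of increasing second coordinate. -/
structure IsConeApex (R : Set (ℝ × ℝ)) (a : ℝ × ℝ) (K : ℝ) : Prop where
  mem : a ∈ R
  pos : 0 < K
  abs_sub_le : ∀ w ∈ R, |w.1 - a.1| ≤ K * (w.2 - a.2)

section Plane

variable {R : Set (ℝ × ℝ)} {μ ν K : ℝ} {a z w : ℝ × ℝ}

namespace OnFace

theorem mem_weakParetoFront (hz : OnFace R μ z) (hμ : 0 ≤ μ) : z ∈ weakParetoFront R := by
  refine ⟨hz.mem, fun w hw => ?_⟩
  by_contra! h
  linarith [hz.le w hw, mul_le_mul_of_nonneg_left h.2.le hμ]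

theorem eq_of_snd_eq (hz : OnFace R μ z) (hw : OnFace R ν w) (h : z.2 = w.2) : z = w := by
  have hzw := hz.le w hw.mem
  have hwz := hw.le z hz.mem
  rw [h] at hzw hwz
  exact Prod.ext (by linarith) h

theorem snd_le (hz : OnFace R μ z) (hw : OnFace R ν w) (h : ν < μ) : z.2 ≤ w.2 := by
  nlinarith [hz.le w hw.mem, hw.le z hz.mem]

theorem fst_le (hz : OnFace R μ z) (hμ : 0 ≤ μ) (hw : w ∈ R) (h : w.2 ≤ z.2) : z.1 ≤ w.1 := by
  linarith [hz.le w hw, mul_le_mul_of_nonneg_left h hμ]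

theorem anti {R' : Set (ℝ × ℝ)} (hz : OnFace R' μ z) (hR : R ⊆ R') (hzR : z ∈ R) :
    OnFace R μ z :=
  ⟨hzR, fun w hw => hz.le w (hR hw)⟩

theorem of_mem_segment (hR : Convex ℝ R) (hz : OnFace R μ z) (hw : OnFace R μ w) {v : ℝ × ℝ}
    (hv : v ∈ segment ℝ z w) : OnFace R μ v := by
  refine ⟨hR.segment_subset hz.mem hw.mem hv, fun u hu => ?_⟩
  obtain ⟨s, t, hs, ht, hst, rfl⟩ := hv
  obtain rfl := eq_sub_of_add_eq hst
  simp only [Prod.fst_add, Prod.snd_add, Prod.smul_fst, Prod.smul_snd, smul_eq_mul]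
  linarith [mul_le_mul_of_nonneg_left (hz.le u hu) hs, mul_le_mul_of_nonneg_left (hw.le u hu) ht]

end OnFace

namespace IsConeApex

theorem snd_le (ha : IsConeApex R a K) (hw : w ∈ R) : a.2 ≤ w.2 :=
  sub_nonneg.1 (nonneg_of_mul_nonneg_right ((abs_nonneg _).trans (ha.abs_sub_le w hw)) ha.pos)

theorem onFace (ha : IsConeApex R a K) (hμ : K ≤ μ) : OnFace R μ a := by
  refine ⟨ha.mem, fun w hw => ?_⟩
  have hmul := mul_le_mul_of_nonneg_right hμ (sub_nonneg.2 (ha.snd_le hw))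
  linarith [(abs_le.1 (ha.abs_sub_le w hw)).1]

theorem eq_of_onFace (ha : IsConeApex R a K) (hμ : K < μ) (hw : OnFace R μ w) : w = a :=
  hw.eq_of_snd_eq (ha.onFace le_rfl)
    ((hw.snd_le (ha.onFace le_rfl) hμ).antisymm (ha.snd_le hw.mem))

end IsConeApex

theorem exists_supporting_weights (hR : Convex ℝ R) (hz : z ∈ weakParetoFront R) :
    ∃ a b : ℝ, 0 ≤ a ∧ 0 ≤ b ∧ 0 < a + b ∧ ∀ w ∈ R, a * z.1 + b * z.2 ≤ a * w.1 + b * w.2 := by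
  have hdisj : Disjoint (Set.Iio z.1 ×ˢ Set.Iio z.2) R := Set.disjoint_left.2 fun w hw hwR =>
    (hz.2 w hwR).elim hw.1.not_ge hw.2.not_ge
  obtain ⟨f, u, hfu, huf⟩ := geometric_hahn_banach_open ((convex_Iio z.1).prod (convex_Iio z.2))
    (isOpen_Iio.prod isOpen_Iio) hR hdisj
  have hf : ∀ w : ℝ × ℝ, f w = f (1, 0) * w.1 + f (0, 1) * w.2 := fun w => by
    rw [mul_comm, mul_comm _ w.2, ← smul_eq_mul, ← smul_eq_mul, ← map_smul, ← map_smul, ← map_add]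
    simp
  have hquadrant : ∀ w ∈ Set.Iic z.1 ×ˢ Set.Iic z.2, f w ≤ u := fun w hw => by
    rw [← closure_Iio, ← closure_Iio, ← closure_prod_eq] at hw
    exact closure_minimal (fun v hv => (hfu v hv).le) (isClosed_le f.continuous continuous_const) hw
  have hzu := huf z hz.1
  have hleft := hquadrant (z.1 - 1, z.2) ⟨(sub_one_lt z.1).le, le_refl z.2⟩
  have hdown := hquadrant (z.1, z.2 - 1) ⟨le_refl z.1, (sub_one_lt z.2).le⟩
  have hboth := hfu (z.1 - 1, z.2 - 1) ⟨sub_one_lt z.1, sub_one_lt z.2⟩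
  rw [hf] at hzu hleft hdown hboth
  refine ⟨f (1, 0), f (0, 1), by linarith, by linarith, by linarith, fun w hw => ?_⟩
  rw [← hf, ← hf]
  exact (hquadrant z ⟨le_refl z.1, le_refl z.2⟩).trans (huf w hw)

theorem IsConeApex.exists_onFace (ha : IsConeApex R a K) (hR : Convex ℝ R)
    (hz : z ∈ weakParetoFront R) : ∃ μ, 0 ≤ μ ∧ OnFace R μ z := by
  obtain ⟨s, t, hs, ht, hst, hmin⟩ := exists_supporting_weights hR hz
  rcases hs.eq_or_lt with rfl | hs
  · have hza : z.2 ≤ a.2 := by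
      have := hmin a ha.mem
      exact le_of_mul_le_mul_left (by linarith) (by linarith : 0 < t)
    have habs := ha.abs_sub_le z hz.1
    rw [hza.antisymm (ha.snd_le hz.1), sub_self, mul_zero, abs_nonpos_iff, sub_eq_zero] at habs
    rw [Prod.ext habs (hza.antisymm (ha.snd_le hz.1))]
    exact ⟨K, ha.pos.le, ha.onFace le_rfl⟩
  · refine ⟨t / s, by positivity, hz.1, fun w hw => ?_⟩
    have hdiv := div_le_div_of_nonneg_right (hmin w hw) hs.le
    rwa [add_div, add_div, mul_div_cancel_left₀ _ hs.ne', mul_div_cancel_left₀ _ hs.ne',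
      mul_div_right_comm, mul_div_right_comm] at hdiv

theorem IsConeApex.snd_le_of_onFace_neg (ha : IsConeApex R a K) (hR : Convex ℝ R)
    (hz : OnFace R ν z) (hν : ν < 0) (hw : w ∈ weakParetoFront R) : w.2 ≤ z.2 := by
  obtain ⟨μ, hμ, hwμ⟩ := ha.exists_onFace hR hw
  exact hwμ.snd_le hz (hν.trans_le hμ)

theorem IsLastOnFace.exists_pivot (hfin : R.Finite) (hz : IsLastOnFace R μ z) :
    (∀ ν < μ, OnFace R ν z) ∨ ∃ ν < μ, OnFace R ν z ∧ ∃ v, z.2 < v.2 ∧ OnFace R ν v := by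
  have hle : ∀ ν < μ, ∀ w ∈ R, w.2 ≤ z.2 → z.1 + ν * z.2 ≤ w.1 + ν * w.2 := fun ν hν w hw hwz => by
    nlinarith [hz.le w hw]
  rcases {w ∈ R | z.2 < w.2}.eq_empty_or_nonempty with hempty | hne
  · exact .inl fun ν hν => ⟨hz.mem, fun w hw =>
      hle ν hν w hw (not_lt.1 (Set.sep_eq_empty_iff_mem_false.1 hempty w hw))⟩
  obtain ⟨v, ⟨hv, hzv⟩, hmax⟩ := Set.exists_max_image _ (fun w => (z.1 - w.1) / (w.2 - z.2))
    (hfin.subset (Set.sep_subset _ _)) hne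
  set ν := (z.1 - v.1) / (v.2 - z.2) with hν
  rw [eq_div_iff (sub_pos.2 hzv).ne'] at hν
  have hνμ : ν < μ := by
    by_contra! h
    exact hzv.not_ge (hz.last v ⟨hv, fun w hw => by nlinarith [hz.le w hw]⟩)
  have hzν : OnFace R ν z := ⟨hz.mem, fun w hw => by
    rcases le_or_gt w.2 z.2 with h | h
    · exact hle ν hνμ w hw h
    · have hslope := hmax w ⟨hw, h⟩
      rw [div_le_iff₀ (sub_pos.2 h)] at hslope
      linarith⟩
  exact .inr ⟨ν, hνμ, hzν, v, hzv, hv, fun w hw => by linarith [hzν.le w hw]⟩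

theorem exists_mem_weakParetoFront_le (hz : z ∈ weakParetoFront R) (hw : w ∈ R) (h : z.1 = w.1) :
    ∃ v ∈ weakParetoFront R, v.1 = w.1 ∧ v.2 ≤ w.2 := by
  rcases le_or_gt z.2 w.2 with hle | hlt
  · exact ⟨z, hz, h, hle⟩
  · exact ⟨w, ⟨hw, fun u hu => (hz.2 u hu).imp h.ge.trans hlt.le.trans⟩, rfl, le_rfl⟩

theorem convexCurve_weakParetoFront (hR : Convex ℝ R)
    (hfst : Convex ℝ (Prod.fst '' weakParetoFront R)) : ConvexCurve (weakParetoFront R) := by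
  rintro x ⟨u, hu, hux, hux'⟩ y ⟨v, hv, hvy, hvy'⟩ a b ha hb hab
  obtain ⟨w, hw, hweq⟩ := hfst (Set.mem_image_of_mem _ hu) (Set.mem_image_of_mem _ hv) ha hb hab
  obtain ⟨p, hp, hp1, hp2⟩ := exists_mem_weakParetoFront_le hw (hR hu.1 hv.1 ha hb hab) hweq
  refine ⟨p, hp, hp1.trans (by simp [hux, hvy]), hp2.trans ?_⟩
  exact add_le_add (mul_le_mul_of_nonneg_left hux' ha) (mul_le_mul_of_nonneg_left hvy' hb)

/-- The points `z 0, …, z n`, listed by strictly increasing second coordinate, are vertices of the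
Pareto front of the convex set `R`: it starts at the cone apex `z 0`, consecutive points share a
face of nonnegative weight, and no front point lies beyond `z n`. -/
structure IsFrontChain (R : Set (ℝ × ℝ)) {n : ℕ} (z : Fin (n + 1) → ℝ × ℝ) : Prop where
  convex : Convex ℝ R
  apex : ∃ K, IsConeApex R (z 0) K
  snd_lt : ∀ i : Fin n, (z i.castSucc).2 < (z i.succ).2
  face : ∀ i : Fin n, ∃ μ, 0 ≤ μ ∧ OnFace R μ (z i.castSucc) ∧ OnFace R μ (z i.succ)
  snd_le_last : ∀ w ∈ weakParetoFront R, w.2 ≤ (z (Fin.last n)).2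

namespace IsFrontChain

variable {n : ℕ} {z : Fin (n + 1) → ℝ × ℝ}

theorem eq_of_snd_eq (h : IsFrontChain R z) {v w : ℝ × ℝ} (hv : v ∈ weakParetoFront R)
    (hw : w ∈ weakParetoFront R) (hvw : v.2 = w.2) : v = w := by
  obtain ⟨K, ha⟩ := h.apex
  obtain ⟨μ, -, hvμ⟩ := ha.exists_onFace h.convex hv
  obtain ⟨ν, -, hwν⟩ := ha.exists_onFace h.convex hw
  exact hvμ.eq_of_snd_eq hwν hvw

theorem vertex_mem (h : IsFrontChain R z) (i : Fin (n + 1)) : z i ∈ weakParetoFront R := by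
  refine Fin.cases ?_ (fun i => ?_) i
  · obtain ⟨K, ha⟩ := h.apex
    exact (ha.onFace le_rfl).mem_weakParetoFront ha.pos.le
  · obtain ⟨μ, hμ, -, hi⟩ := h.face i
    exact hi.mem_weakParetoFront hμ

theorem segment_subset (h : IsFrontChain R z) (i : Fin n) :
    segment ℝ (z i.castSucc) (z i.succ) ⊆ weakParetoFront R := fun v hv => by
  obtain ⟨μ, hμ, hi, hi'⟩ := h.face i
  exact (hi.of_mem_segment h.convex hi' hv).mem_weakParetoFront hμ

theorem weakParetoFront_eq (h : IsFrontChain R z) : weakParetoFront R = polygonalChain z := by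
  have hsub : polygonalChain z ⊆ weakParetoFront R :=
    Set.union_subset (Set.range_subset_iff.2 h.vertex_mem) (Set.iUnion_subset h.segment_subset)
  refine Set.Subset.antisymm (fun w hw => ?_) hsub
  obtain ⟨K, ha⟩ := h.apex
  obtain ⟨v, hv, hvw⟩ := (convex_image_polygonalChain z continuous_snd).ordConnected.out
    (Set.mem_image_of_mem _ (vertex_mem_polygonalChain z 0))
    (Set.mem_image_of_mem _ (vertex_mem_polygonalChain z (Fin.last n)))
    ⟨ha.snd_le hw.1, h.snd_le_last w hw⟩
  exact h.eq_of_snd_eq (hsub hv) hw hvw ▸ hv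

theorem strictMono_snd (h : IsFrontChain R z) : StrictMono fun i => (z i).2 :=
  Fin.strictMono_iff_lt_succ.2 h.snd_lt

theorem antitone_fst (h : IsFrontChain R z) : Antitone fun i => (z i).1 :=
  Fin.antitone_iff_succ_le.2 fun i => by
    obtain ⟨μ, hμ, hi, hi'⟩ := h.face i
    exact hi'.fst_le hμ hi.mem (h.snd_lt i).le

theorem decreasingCurve (h : IsFrontChain R z) : DecreasingCurve (weakParetoFront R) :=
  fun v hv _ hw hlt => ((hw.2 v hv.1).resolve_left hlt.not_ge).lt_of_ne fun heq =>
    hlt.ne (congrArg Prod.fst (h.eq_of_snd_eq hv hw heq.symm))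

theorem convexCurve (h : IsFrontChain R z) : ConvexCurve (weakParetoFront R) :=
  convexCurve_weakParetoFront h.convex
    (h.weakParetoFront_eq ▸ convex_image_polygonalChain z continuous_fst)

theorem exists_eq_of_isCurveCorner (h : IsFrontChain R z) {v : ℝ × ℝ}
    (hv : IsCurveCorner (weakParetoFront R) v) : ∃ i, z i = v := by
  obtain ⟨hvR, hcorner⟩ := hv
  rw [h.weakParetoFront_eq] at hvR
  rcases hvR with hvertex | hsegment
  · exact hvertex
  · obtain ⟨i, hi⟩ := Set.mem_iUnion.1 hsegment
    by_contra! hne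
    have heq := hcorner _ _ (h.segment_subset i)
      (mem_openSegment_of_ne_left_right (hne _) (hne _) hi)
    exact (h.snd_lt i).ne (congrArg Prod.snd heq)

end IsFrontChain

end Plane

/-! ### Optimal residual levels -/

/-- Convexity of `f` on the integers `0, …, N`: its increments are nondecreasing there. -/
def ConvexUpTo (N : ℕ) (f : ℕ → ℝ) : Prop :=
  ∀ i, i + 2 ≤ N → f (i + 1) - f i ≤ f (i + 2) - f (i + 1)

namespace ConvexUpTo

variable {N : ℕ} {f g : ℕ → ℝ} {a b : ℕ}

theorem exchange (hf : ConvexUpTo N f) (hab : a ≤ b) (hb : b + 1 ≤ N) :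
    f (a + 1) + f b ≤ f a + f (b + 1) := by
  induction b, hab using Nat.le_induction with
  | base => linarith
  | succ b _ ih => linarith [ih (by omega), hf b hb]

theorem add (hf : ConvexUpTo N f) (hg : ConvexUpTo N g) : ConvexUpTo N fun n => f n + g n :=
  fun i hi => by linarith [hf i hi, hg i hi]

theorem const_mul (hf : ConvexUpTo N f) {r : ℝ} (hr : 0 ≤ r) : ConvexUpTo N fun n => r * f n :=
  fun i hi => by linarith [mul_le_mul_of_nonneg_left (hf i hi) hr]

theorem comp_add_right {m : ℕ} (hf : ConvexUpTo (N + m) f) : ConvexUpTo N fun n => f (n + m) :=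
  fun i hi => by
    simpa only [add_right_comm _ m] using hf (i + m) (by omega)

theorem mono {N' : ℕ} (hf : ConvexUpTo N f) (h : N' ≤ N) : ConvexUpTo N' f :=
  fun i hi => hf i (hi.trans h)

end ConvexUpTo

namespace BufferModel

section Levels

variable (M : BufferModel)

/-- In state `q` one may transmit so that the residual level, the number of packets left before
the next arrivals, is `x`. Actions are encoded by residual levels from here on. -/
def AdmLevel (q x : ℕ) : Prop := x ≤ q ∧ q ≤ x + M.S ∧ x + M.A ≤ M.Q

/-- The cost of leaving `x` packets in state `q`: transmission power plus a terminal cost `w`. -/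
def levelCost (w : ℕ → ℝ) (q x : ℕ) : ℝ := M.P (q - x) + w x

/-- The admissible residual levels in state `q` of least cost. -/
def optLevels (w : ℕ → ℝ) (q : ℕ) : Set ℕ :=
  {x | M.AdmLevel q x ∧ ∀ y, M.AdmLevel q y → M.levelCost w q x ≤ M.levelCost w q y}

/-- The least optimal residual level. -/
noncomputable def loLevel (w : ℕ → ℝ) (q : ℕ) : ℕ := sInf (M.optLevels w q)

/-- The greatest optimal residual level. -/
noncomputable def hiLevel (w : ℕ → ℝ) (q : ℕ) : ℕ := sSup (M.optLevels w q)

/-- The least cost of transmission power plus terminal cost in state `q`. -/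
noncomputable def minCost (w : ℕ → ℝ) (q : ℕ) : ℝ := M.levelCost w q (M.loLevel w q)

/-- Admissible residual levels for all states, such that both the residual level and the number of
transmitted packets are nondecreasing in the state. -/
structure MonoLevels (x : ℕ → ℕ) : Prop where
  adm : ∀ q ≤ M.Q, M.AdmLevel q (x q)
  le_succ : ∀ q, q + 1 ≤ M.Q → x q ≤ x (q + 1)
  succ_le : ∀ q, q + 1 ≤ M.Q → x (q + 1) ≤ x q + 1

/-- The expectation of `h` at the next state when `x` packets are left after transmission. -/
def nextMean (h : ℕ → ℝ) (x : ℕ) : ℝ := (1 - M.α) * h x + M.α * h (x + M.A)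

variable {M} {w : ℕ → ℝ} {q a b x : ℕ}

theorem levelCost_exchange_power (hba : b ≤ a) (ha : a ≤ q) (hb : q + 1 ≤ b + M.S) :
    M.levelCost w q b + M.levelCost w (q + 1) a ≤
      M.levelCost w q a + M.levelCost w (q + 1) b := by
  have h := ConvexUpTo.exchange M.P_convex (a := q - a) (b := q - b) (by omega) (by omega)
  rw [show q - a + 1 = q + 1 - a by omega, show q - b + 1 = q + 1 - b by omega] at h
  unfold levelCost
  linarith

theorem levelCost_exchange_terminal (hw : ConvexUpTo (M.Q - M.A) w) (hab : a ≤ b)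
    (hb : b + 1 ≤ M.Q - M.A) :
    M.levelCost w q b + M.levelCost w (q + 1) (a + 1) ≤
      M.levelCost w q a + M.levelCost w (q + 1) (b + 1) := by
  simp only [levelCost, Nat.add_sub_add_right]
  linarith [hw.exchange hab hb]

theorem levelCost_exchange (hw : ConvexUpTo (M.Q - M.A) w) (ha : M.AdmLevel q a)
    (hb : M.AdmLevel q (b + 1)) (hab : a ≤ b) :
    M.levelCost w q (a + 1) + M.levelCost w q b ≤
      M.levelCost w q a + M.levelCost w q (b + 1) := by
  obtain ⟨ha₁, ha₂, ha₃⟩ := ha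
  obtain ⟨hb₁, -, hb₃⟩ := hb
  have h := ConvexUpTo.exchange M.P_convex (a := q - (b + 1)) (b := q - (a + 1)) (by omega)
    (by omega)
  rw [show q - (b + 1) + 1 = q - b by omega, show q - (a + 1) + 1 = q - a by omega] at h
  unfold levelCost
  linarith [hw.exchange hab (by omega)]

theorem exists_admLevel (hq : q ≤ M.Q) : ∃ x, M.AdmLevel q x := by
  have := M.A_le_S
  have := M.A_le_Q
  exact ⟨q - M.S, by omega, by omega, by omega⟩

theorem optLevels_nonempty (w : ℕ → ℝ) (hq : q ≤ M.Q) : (M.optLevels w q).Nonempty :=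
  Set.exists_min_image {x | M.AdmLevel q x} (M.levelCost w q)
    ((Set.finite_Iic q).subset fun _ hx => hx.1) (exists_admLevel hq)

theorem optLevels_bddAbove (w : ℕ → ℝ) (q : ℕ) : BddAbove (M.optLevels w q) :=
  ⟨q, fun _ hx => hx.1.1⟩

theorem loLevel_mem (w : ℕ → ℝ) (hq : q ≤ M.Q) : M.loLevel w q ∈ M.optLevels w q :=
  Nat.sInf_mem (optLevels_nonempty w hq)

theorem hiLevel_mem (w : ℕ → ℝ) (hq : q ≤ M.Q) : M.hiLevel w q ∈ M.optLevels w q :=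
  Nat.sSup_mem (optLevels_nonempty w hq) (optLevels_bddAbove w q)

theorem loLevel_le (hx : x ∈ M.optLevels w q) : M.loLevel w q ≤ x :=
  Nat.sInf_le hx

theorem le_hiLevel (hx : x ∈ M.optLevels w q) : x ≤ M.hiLevel w q :=
  le_csSup (optLevels_bddAbove w q) hx

theorem mem_optLevels_of_lt (ha : a ∈ M.optLevels w q) (hb : b ∈ M.optLevels w (q + 1))
    (hab : b < a) : b ∈ M.optLevels w q ∧ a ∈ M.optLevels w (q + 1) := by
  obtain ⟨⟨ha₁, ha₂, ha₃⟩, ha₄⟩ := ha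
  obtain ⟨⟨hb₁, hb₂, hb₃⟩, hb₄⟩ := hb
  have hqb : M.AdmLevel q b := ⟨by omega, by omega, hb₃⟩
  have hqa : M.AdmLevel (q + 1) a := ⟨by omega, by omega, ha₃⟩
  have h := levelCost_exchange_power (w := w) hab.le ha₁ hb₂
  exact ⟨⟨hqb, fun y hy => by linarith [ha₄ y hy, hb₄ a hqa]⟩,
    ⟨hqa, fun y hy => by linarith [hb₄ y hy, ha₄ b hqb]⟩⟩

theorem mem_optLevels_of_succ_lt (hw : ConvexUpTo (M.Q - M.A) w) (ha : a ∈ M.optLevels w q)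
    (hb : b + 1 ∈ M.optLevels w (q + 1)) (hab : a < b) :
    b ∈ M.optLevels w q ∧ a + 1 ∈ M.optLevels w (q + 1) := by
  obtain ⟨⟨ha₁, ha₂, ha₃⟩, ha₄⟩ := ha
  obtain ⟨⟨hb₁, hb₂, hb₃⟩, hb₄⟩ := hb
  have hqb : M.AdmLevel q b := ⟨by omega, by omega, by omega⟩
  have hqa : M.AdmLevel (q + 1) (a + 1) := ⟨by omega, by omega, by omega⟩
  have h := levelCost_exchange_terminal (q := q) hw hab.le (by omega)
  exact ⟨⟨hqb, fun y hy => by linarith [ha₄ y hy, hb₄ _ hqa]⟩,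
    ⟨hqa, fun y hy => by linarith [hb₄ y hy, ha₄ b hqb]⟩⟩

theorem mem_optLevels_of_between (hw : ConvexUpTo (M.Q - M.A) w) (ha : a ∈ M.optLevels w q)
    (hb : b ∈ M.optLevels w q) (hax : a ≤ x) (hxb : x ≤ b) : x ∈ M.optLevels w q := by
  induction x, hax using Nat.le_induction with
  | base => exact ha
  | succ a _ ih =>
    obtain ⟨ha, hamin⟩ := ih (by omega)
    obtain ⟨c, rfl⟩ : ∃ c, b = c + 1 := ⟨b - 1, by omega⟩
    obtain ⟨⟨hb₁, hb₂, hb₃⟩, hbmin⟩ := hb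
    have ⟨ha₁, ha₂, ha₃⟩ := ha
    have h := levelCost_exchange hw ha ⟨hb₁, hb₂, hb₃⟩ (by omega)
    have hc := hamin c ⟨by omega, by omega, by omega⟩
    exact ⟨⟨by omega, by omega, by omega⟩, fun y hy => by linarith [hbmin y hy]⟩

theorem monoLevels_loLevel (hw : ConvexUpTo (M.Q - M.A) w) : M.MonoLevels (M.loLevel w) where
  adm q hq := (loLevel_mem w hq).1
  le_succ q hq := by
    by_contra! h
    exact h.not_ge (loLevel_le
      (mem_optLevels_of_lt (loLevel_mem w (by omega)) (loLevel_mem w hq) h).1)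
  succ_le q hq := by
    by_contra! h
    obtain ⟨b, hb⟩ : ∃ b, M.loLevel w (q + 1) = b + 1 := ⟨M.loLevel w (q + 1) - 1, by omega⟩
    exact h.not_ge (loLevel_le (mem_optLevels_of_succ_lt hw (loLevel_mem w (by omega))
      (hb ▸ loLevel_mem w hq) (by omega)).2)

theorem monoLevels_hiLevel (hw : ConvexUpTo (M.Q - M.A) w) : M.MonoLevels (M.hiLevel w) where
  adm q hq := (hiLevel_mem w hq).1
  le_succ q hq := by
    by_contra! h
    exact h.not_ge (le_hiLevel
      (mem_optLevels_of_lt (hiLevel_mem w (by omega)) (hiLevel_mem w hq) h).2)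
  succ_le q hq := by
    by_contra! h
    obtain ⟨b, hb⟩ : ∃ b, M.hiLevel w (q + 1) = b + 1 := ⟨M.hiLevel w (q + 1) - 1, by omega⟩
    have := le_hiLevel (mem_optLevels_of_succ_lt hw (hiLevel_mem w (by omega))
      (hb ▸ hiLevel_mem w hq) (by omega)).1
    omega

theorem minCost_le (hx : M.AdmLevel q x) (hq : q ≤ M.Q) : M.minCost w q ≤ M.levelCost w q x :=
  (loLevel_mem w hq).2 x hx

theorem minCost_eq (hx : x ∈ M.optLevels w q) (hq : q ≤ M.Q) :
    M.minCost w q = M.levelCost w q x :=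
  (minCost_le hx.1 hq).antisymm (hx.2 _ (loLevel_mem w hq).1)

theorem convexUpTo_minCost (hw : ConvexUpTo (M.Q - M.A) w) : ConvexUpTo M.Q (M.minCost w) := by
  intro q hq
  suffices h : ∀ a b, M.AdmLevel q a → M.AdmLevel (q + 2) b →
      M.minCost w (q + 1) + M.minCost w (q + 1) ≤ M.levelCost w q a + M.levelCost w (q + 2) b by
    linarith [h _ _ (loLevel_mem w (by omega)).1 (loLevel_mem w hq).1,
      show M.minCost w q = M.levelCost w q _ from rfl,
      show M.minCost w (q + 2) = M.levelCost w (q + 2) _ from rfl]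
  rintro a b ⟨ha₁, ha₂, ha₃⟩ ⟨hb₁, hb₂, hb₃⟩
  have hmin : ∀ x, M.AdmLevel (q + 1) x → M.minCost w (q + 1) ≤ M.levelCost w (q + 1) x :=
    fun x hx => minCost_le hx (by omega)
  rcases lt_trichotomy b (a + 1) with hba | rfl | hab
  · have h := ConvexUpTo.exchange M.P_convex (a := q - a) (b := q + 1 - b) (by omega) (by omega)
    rw [show q - a + 1 = q + 1 - a by omega, show q + 1 - b + 1 = q + 2 - b by omega] at h
    have ha := hmin a ⟨by omega, by omega, ha₃⟩
    have hb := hmin b ⟨by omega, by omega, hb₃⟩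
    unfold levelCost at ha hb ⊢
    linarith
  · have ha := hmin a ⟨by omega, by omega, ha₃⟩
    have hb := hmin (a + 1) ⟨by omega, by omega, hb₃⟩
    unfold levelCost at ha hb ⊢
    rw [Nat.add_sub_add_right] at hb
    rw [show q + 2 - (a + 1) = q + 1 - a by omega]
    linarith
  · obtain ⟨c, rfl⟩ : ∃ c, b = c + 1 := ⟨b - 1, by omega⟩
    have ha := hmin (a + 1) ⟨by omega, by omega, by omega⟩
    have hc := hmin c ⟨by omega, by omega, by omega⟩
    unfold levelCost at ha hc ⊢
    rw [Nat.add_sub_add_right] at ha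
    rw [show q + 2 - (c + 1) = q + 1 - c by omega]
    linarith [hw.exchange (a := a) (b := c) (by omega) (by omega)]

theorem convexUpTo_nextMean {h : ℕ → ℝ} (hh : ConvexUpTo M.Q h) :
    ConvexUpTo (M.Q - M.A) (M.nextMean h) :=
  ((hh.mono (Nat.sub_le _ _)).const_mul (sub_nonneg.2 M.α_lt_one.le)).add
    (ConvexUpTo.comp_add_right (by rwa [Nat.sub_add_cancel M.A_le_Q]) |>.const_mul M.α_pos.le)

end Levels

end BufferModel

/-! ### Expectations and time averages -/

theorem sum_listVector_succ {β R : Type*} [Fintype β] [AddCommMonoid R] (k : ℕ)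
    (f : List.Vector β (k + 1) → R) :
    ∑ v, f v = ∑ v : List.Vector β k, ∑ p : β, f (p ::ᵥ v) := by
  rw [Finset.sum_comm, ← Fintype.sum_prod_type']
  exact (Fintype.sum_equiv
    (⟨fun p => p.1 ::ᵥ p.2, fun v => (v.head, v.tail), fun p => by simp, fun v => by simp⟩ :
      β × List.Vector β k ≃ List.Vector β (k + 1)) _ _ fun p => rfl).symm

theorem exists_abs_le (f : ℕ → ℝ) (N : ℕ) : ∃ C, ∀ n ≤ N, |f n| ≤ C :=
  ⟨∑ n ∈ Finset.range (N + 1), |f n|, fun n hn =>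
    Finset.single_le_sum (f := fun n => |f n|) (fun i _ => abs_nonneg _)
      (Finset.mem_range.2 (by omega))⟩

theorem tendsto_one_div_mul_of_bounded {u : ℕ → ℝ} {C : ℝ} (hu : ∀ n, |u n| ≤ C) :
    Tendsto (fun N : ℕ => 1 / (N : ℝ) * u N) atTop (𝓝 0) :=
  tendsto_one_div_atTop_nhds_zero_nat.zero_mul_isBoundedUnder_le
    (isBoundedUnder_of ⟨C, hu⟩)

namespace BufferModel

variable {M : BufferModel}

section NextMean

variable {f g : ℕ → ℝ} {x y : ℕ}

theorem nextMean_add (f g : ℕ → ℝ) (x : ℕ) :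
    M.nextMean (fun n => f n + g n) x = M.nextMean f x + M.nextMean g x := by
  unfold nextMean
  ring

theorem nextMean_const_mul (a : ℝ) (f : ℕ → ℝ) (x : ℕ) :
    M.nextMean (fun n => a * f n) x = a * M.nextMean f x := by
  unfold nextMean
  ring

theorem nextMean_const (a : ℝ) (x : ℕ) : M.nextMean (fun _ => a) x = a := by
  unfold nextMean
  ring

theorem nextMean_natCast (x : ℕ) : M.nextMean (fun n => (n : ℝ)) x = x + M.α * M.A := by
  unfold nextMean
  push_cast
  ring

theorem nextMean_le_nextMean (h : f x ≤ g y) (hA : f (x + M.A) ≤ g (y + M.A)) :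
    M.nextMean f x ≤ M.nextMean g y :=
  add_le_add (mul_le_mul_of_nonneg_left h (sub_nonneg.2 M.α_lt_one.le))
    (mul_le_mul_of_nonneg_left hA M.α_pos.le)

end NextMean

section Expectation

theorem Allowed.admLevel {q : M.State} {s : M.Action} (h : M.Allowed q s) :
    M.AdmLevel q ((q : ℕ) - (s : ℕ)) := by
  obtain ⟨h₁, h₂⟩ := h
  exact ⟨by omega, by omega, by omega⟩

theorem trans_nonneg (q : M.State) (s : M.Action) (j : M.State) : 0 ≤ M.trans q s j := by
  unfold trans
  split_ifs
  exacts [M.α_pos.le, sub_nonneg.2 M.α_lt_one.le, le_rfl]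

theorem sum_trans_mul {q : M.State} {s : M.Action} (h : M.Allowed q s) (f : ℕ → ℝ) :
    ∑ j : M.State, M.trans q s j * f j = M.nextMean f ((q : ℕ) - (s : ℕ)) := by
  obtain ⟨-, -, hx⟩ := h.admLevel
  have hA := M.one_le_A
  have hs := h.1
  have htrans : ∀ j : M.State, M.trans q s j * f j =
      (if j = ⟨(q : ℕ) - (s : ℕ), by omega⟩ then (1 - M.α) * f j else 0) +
      (if j = ⟨(q : ℕ) - (s : ℕ) + M.A, by omega⟩ then M.α * f j else 0) := by
    intro j
    simp only [trans, Fin.ext_iff]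
    split_ifs <;> first | omega | ring
  simp_rw [htrans, Finset.sum_add_distrib]
  simp [nextMean]

theorem histProb_nonneg (γ : M.Policy) (q₀ : M.State) : ∀ h q, 0 ≤ M.histProb γ q₀ h q
  | [], q => by
    unfold histProb
    split_ifs
    exacts [zero_le_one, le_rfl]
  | (q', s') :: h, q => mul_nonneg
      (mul_nonneg (histProb_nonneg γ q₀ h q') (γ.nonneg h q' s')) (trans_nonneg q' s' q)

variable (γ : M.Policy) (q₀ : M.State) (c c' : M.State → M.Action → ℝ) (k N : ℕ)

theorem sum_histProb_mul_rule_mul (h : List (M.State × M.Action)) (q : M.State) (a : ℝ) :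
    ∑ s, M.histProb γ q₀ h q * γ.rule h q s * a = M.histProb γ q₀ h q * a := by
  rw [← Finset.sum_mul, ← Finset.mul_sum, γ.sum_eq_one, mul_one]

variable {c c'} in
theorem stageMean_mono (h : ∀ q s, M.Allowed q s → c q s ≤ c' q s) :
    M.stageMean γ q₀ c k ≤ M.stageMean γ q₀ c' k := by
  refine Finset.sum_le_sum fun v _ => Finset.sum_le_sum fun q _ => Finset.sum_le_sum fun s _ => ?_
  by_cases hs : M.Allowed q s
  · exact mul_le_mul_of_nonneg_left (h q s hs)
      (mul_nonneg (histProb_nonneg γ q₀ _ q) (γ.nonneg _ q s))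
  · simp [γ.feasible _ q s hs]

theorem stageMean_add :
    M.stageMean γ q₀ (fun q s => c q s + c' q s) k =
      M.stageMean γ q₀ c k + M.stageMean γ q₀ c' k := by
  simp only [stageMean, mul_add, Finset.sum_add_distrib]

theorem stageMean_const_mul (a : ℝ) :
    M.stageMean γ q₀ (fun q s => a * c q s) k = a * M.stageMean γ q₀ c k := by
  simp only [stageMean, Finset.mul_sum, mul_left_comm a]

theorem stageMean_state_succ (f : ℕ → ℝ) :
    M.stageMean γ q₀ (fun q _ => f q) (k + 1) =
      M.stageMean γ q₀ (fun q s => M.nextMean f ((q : ℕ) - (s : ℕ))) k := by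
  unfold stageMean
  simp only [sum_histProb_mul_rule_mul]
  rw [sum_listVector_succ]
  refine Finset.sum_congr rfl fun v _ => ?_
  rw [Fintype.sum_prod_type]
  refine Finset.sum_congr rfl fun q _ => Finset.sum_congr rfl fun s _ => ?_
  simp only [List.Vector.toList_cons, histProb]
  by_cases hs : M.Allowed q s
  · rw [← sum_trans_mul hs, Finset.mul_sum]
    exact Finset.sum_congr rfl fun j _ => mul_assoc _ _ _
  · simp [γ.feasible _ q s hs]

theorem stageMean_const (a : ℝ) : M.stageMean γ q₀ (fun _ _ => a) k = a := by
  induction k with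
  | zero =>
    simp only [stageMean, sum_histProb_mul_rule_mul]
    simp [histProb]
  | succ k ih =>
    rw [stageMean_state_succ γ q₀ k fun _ => a]
    simpa only [nextMean_const] using ih

variable {γ q₀ k} in
theorem abs_stageMean_state_le {f : ℕ → ℝ} {C : ℝ} (hC : ∀ n ≤ M.Q, |f n| ≤ C) :
    |M.stageMean γ q₀ (fun q _ => f q) k| ≤ C := by
  rw [abs_le]
  constructor
  · rw [← stageMean_const γ q₀ k (-C)]
    exact stageMean_mono γ q₀ k fun q s _ => (abs_le.1 (hC q (by omega))).1
  · rw [← stageMean_const γ q₀ k C]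
    exact stageMean_mono γ q₀ k fun q s _ => (abs_le.1 (hC q (by omega))).2

variable {c c'} in
theorem timeAverage_mono (h : ∀ q s, M.Allowed q s → c q s ≤ c' q s) :
    M.timeAverage γ q₀ c N ≤ M.timeAverage γ q₀ c' N :=
  mul_le_mul_of_nonneg_left (Finset.sum_le_sum fun k _ => stageMean_mono γ q₀ k h)
    (by positivity)

theorem timeAverage_add :
    M.timeAverage γ q₀ (fun q s => c q s + c' q s) N =
      M.timeAverage γ q₀ c N + M.timeAverage γ q₀ c' N := by
  simp only [timeAverage, stageMean_add, Finset.sum_add_distrib, mul_add]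

theorem timeAverage_const_mul (a : ℝ) :
    M.timeAverage γ q₀ (fun q s => a * c q s) N = a * M.timeAverage γ q₀ c N := by
  simp only [timeAverage, stageMean_const_mul, ← Finset.mul_sum, mul_left_comm a]

variable {N} in
theorem timeAverage_const (a : ℝ) (hN : N ≠ 0) : M.timeAverage γ q₀ (fun _ _ => a) N = a := by
  simp only [timeAverage, stageMean_const, Finset.sum_const, Finset.card_range, nsmul_eq_mul]
  field_simp

/-- The expected decrease of the potential `f` over a timeslot in which `s` packets are transmitted
in state `q`. -/
def drift (M : BufferModel) (f : ℕ → ℝ) (q : M.State) (s : M.Action) : ℝ :=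
  f q - M.nextMean f ((q : ℕ) - (s : ℕ))

theorem stageMean_drift (f : ℕ → ℝ) :
    M.stageMean γ q₀ (M.drift f) k =
      M.stageMean γ q₀ (fun q _ => f q) k - M.stageMean γ q₀ (fun q _ => f q) (k + 1) := by
  rw [stageMean_state_succ, eq_sub_iff_add_eq, ← stageMean_add]
  simp only [drift, sub_add_cancel]

theorem tendsto_timeAverage_drift (f : ℕ → ℝ) :
    Tendsto (M.timeAverage γ q₀ (M.drift f)) atTop (𝓝 0) := by
  obtain ⟨C, hC⟩ := exists_abs_le f M.Q
  refine tendsto_one_div_mul_of_bounded (C := C + C) fun N => ?_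
  simp only [stageMean_drift]
  rw [Finset.sum_range_sub']
  exact (abs_sub _ _).trans (add_le_add (abs_stageMean_state_le hC) (abs_stageMean_state_le hC))

theorem tendsto_timeAverage_const_add_drift (g : ℝ) (f : ℕ → ℝ) :
    Tendsto (M.timeAverage γ q₀ fun q s => g + M.drift f q s) atTop (𝓝 g) := by
  have h := (tendsto_timeAverage_drift γ q₀ f).const_add g
  rw [add_zero] at h
  refine h.congr' ?_
  filter_upwards [eventually_ne_atTop 0] with N hN
  rw [timeAverage_add γ q₀ (fun _ _ => g), timeAverage_const γ q₀ g hN]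

variable {γ q₀ c} {g ℓ : ℝ} {f : ℕ → ℝ}

theorem le_of_tendsto_timeAverage (hc : ∀ q s, M.Allowed q s → g + M.drift f q s ≤ c q s)
    (hℓ : Tendsto (M.timeAverage γ q₀ c) atTop (𝓝 ℓ)) : g ≤ ℓ :=
  le_of_tendsto_of_tendsto' (tendsto_timeAverage_const_add_drift γ q₀ g f) hℓ
    fun N => timeAverage_mono γ q₀ N hc

theorem abs_sub_le_of_tendsto_timeAverage {r : M.State → M.Action → ℝ} {K ρ : ℝ}
    (hc : ∀ q s, M.Allowed q s → |c q s - (g + M.drift f q s)| ≤ K * r q s)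
    (hℓ : Tendsto (M.timeAverage γ q₀ c) atTop (𝓝 ℓ))
    (hρ : Tendsto (M.timeAverage γ q₀ r) atTop (𝓝 ρ)) : |ℓ - g| ≤ K * ρ := by
  have hg := tendsto_timeAverage_const_add_drift γ q₀ g f
  refine abs_sub_le_iff.2 ⟨sub_le_iff_le_add.2 ?_, sub_le_iff_le_add.2 ?_⟩
  · refine le_of_tendsto_of_tendsto' hℓ ((hρ.const_mul K).add hg) fun N => ?_
    rw [← timeAverage_const_mul, ← timeAverage_add]
    exact timeAverage_mono γ q₀ N fun q s hs => by linarith [(abs_le.1 (hc q s hs)).2]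
  · refine le_of_tendsto_of_tendsto' hg ((hρ.const_mul K).add hℓ) fun N => ?_
    rw [← timeAverage_const_mul, ← timeAverage_add]
    exact timeAverage_mono γ q₀ N fun q s hs => by linarith [(abs_le.1 (hc q s hs)).1]

variable {c' N} in
theorem DetPolicy.timeAverage_congr (F : M.DetPolicy) (h : ∀ q, c q (F.act q) = c' q (F.act q)) :
    M.timeAverage F.toPolicy q₀ c N = M.timeAverage F.toPolicy q₀ c' N := by
  simp [timeAverage, stageMean, DetPolicy.toPolicy, h]

theorem DetPolicy.tendsto_timeAverage (F : M.DetPolicy)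
    (hc : ∀ q, c q (F.act q) = g + M.drift f q (F.act q)) :
    Tendsto (M.timeAverage F.toPolicy q₀ c) atTop (𝓝 g) :=
  (tendsto_timeAverage_const_add_drift F.toPolicy q₀ g f).congr fun _ =>
    F.timeAverage_congr fun q => (hc q).symm

end Expectation

end BufferModel

/-! ### The feasible region -/

namespace BufferModel

variable {M : BufferModel}

section Mixture

namespace Policy

variable (γ γ' : M.Policy) (q₀ : M.State) {a b : ℝ}

/-- The probability of a history and current state when `γ` is chosen with probability `a` and `γ'`
with probability `b` before the first timeslot. -/
noncomputable def mixWeight (a b : ℝ) (h : List (M.State × M.Action)) (q : M.State) : ℝ :=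
  a * M.histProb γ q₀ h q + b * M.histProb γ' q₀ h q

theorem mixWeight_nonneg (ha : 0 ≤ a) (hb : 0 ≤ b) (h : List (M.State × M.Action))
    (q : M.State) : 0 ≤ γ.mixWeight γ' q₀ a b h q :=
  add_nonneg (mul_nonneg ha (histProb_nonneg _ _ _ _)) (mul_nonneg hb (histProb_nonneg _ _ _ _))

open scoped Classical in
/-- The policy with the law of the random choice, before the first timeslot, of `γ` with
probability `a` and of `γ'` with probability `b`: its decisions are the conditional probabilities
given the history. On histories of probability zero it follows `γ`. -/
noncomputable def mix (ha : 0 ≤ a) (hb : 0 ≤ b) : M.Policy where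
  rule h q s := if γ.mixWeight γ' q₀ a b h q = 0 then γ.rule h q s else
    (a * M.histProb γ q₀ h q * γ.rule h q s + b * M.histProb γ' q₀ h q * γ'.rule h q s) /
      γ.mixWeight γ' q₀ a b h q
  nonneg h q s := by
    split_ifs
    · exact γ.nonneg h q s
    · exact div_nonneg (add_nonneg
        (mul_nonneg (mul_nonneg ha (histProb_nonneg _ _ _ _)) (γ.nonneg h q s))
        (mul_nonneg (mul_nonneg hb (histProb_nonneg _ _ _ _)) (γ'.nonneg h q s)))
        (γ.mixWeight_nonneg γ' q₀ ha hb h q)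
  sum_eq_one h q := by
    split_ifs with h₀
    · exact γ.sum_eq_one h q
    · rw [← Finset.sum_div, Finset.sum_add_distrib, ← Finset.mul_sum, ← Finset.mul_sum,
        γ.sum_eq_one, γ'.sum_eq_one, mul_one, mul_one]
      exact div_self h₀
  feasible h q s hs := by
    simp [γ.feasible h q s hs, γ'.feasible h q s hs]

theorem mixWeight_mul_rule (ha : 0 ≤ a) (hb : 0 ≤ b) (h : List (M.State × M.Action))
    (q : M.State) (s : M.Action) :
    γ.mixWeight γ' q₀ a b h q * (γ.mix γ' q₀ ha hb).rule h q s =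
      a * M.histProb γ q₀ h q * γ.rule h q s + b * M.histProb γ' q₀ h q * γ'.rule h q s := by
  by_cases h₀ : γ.mixWeight γ' q₀ a b h q = 0
  · obtain ⟨hγ, hγ'⟩ := (add_eq_zero_iff_of_nonneg (mul_nonneg ha (histProb_nonneg γ q₀ h q))
      (mul_nonneg hb (histProb_nonneg γ' q₀ h q))).1 h₀
    rw [h₀, hγ, hγ']
    ring
  · simp only [mix, if_neg h₀]
    exact mul_div_cancel₀ _ h₀

theorem histProb_mix (ha : 0 ≤ a) (hb : 0 ≤ b) (hab : a + b = 1) :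
    ∀ h q, M.histProb (γ.mix γ' q₀ ha hb) q₀ h q = γ.mixWeight γ' q₀ a b h q
  | [], q => by
    rw [mixWeight, histProb, histProb, histProb, ← add_mul, hab, one_mul]
  | (q', s') :: h, q => by
    rw [histProb, histProb_mix ha hb hab h q', mixWeight_mul_rule, mixWeight, histProb, histProb]
    ring

theorem stageMean_mix (ha : 0 ≤ a) (hb : 0 ≤ b) (hab : a + b = 1)
    (c : M.State → M.Action → ℝ) (k : ℕ) :
    M.stageMean (γ.mix γ' q₀ ha hb) q₀ c k =
      a * M.stageMean γ q₀ c k + b * M.stageMean γ' q₀ c k := by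
  simp only [stageMean, histProb_mix γ γ' q₀ ha hb hab, mixWeight_mul_rule, Finset.mul_sum,
    ← Finset.sum_add_distrib]
  refine Finset.sum_congr rfl fun v _ => Finset.sum_congr rfl fun q _ =>
    Finset.sum_congr rfl fun s _ => ?_
  ring

theorem timeAverage_mix (ha : 0 ≤ a) (hb : 0 ≤ b) (hab : a + b = 1)
    (c : M.State → M.Action → ℝ) (N : ℕ) :
    M.timeAverage (γ.mix γ' q₀ ha hb) q₀ c N =
      a * M.timeAverage γ q₀ c N + b * M.timeAverage γ' q₀ c N := by
  simp only [timeAverage, stageMean_mix γ γ' q₀ ha hb hab, Finset.sum_add_distrib,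
    ← Finset.mul_sum]
  ring

end Policy

theorem convex_region (q₀ : M.State) : Convex ℝ (M.region q₀) := by
  rintro z ⟨γ, hP, hD⟩ z' ⟨γ', hP', hD'⟩ a b ha hb hab
  refine ⟨γ.mix γ' q₀ ha hb, ?_, ?_⟩
  · exact ((hP.const_mul a).add (hP'.const_mul b)).congr fun N =>
      (γ.timeAverage_mix γ' q₀ ha hb hab _ N).symm
  · refine ((hD.const_mul a).add (hD'.const_mul b)).congr fun N => ?_
    rw [γ.timeAverage_mix γ' q₀ ha hb hab]
    ring

end Mixture

section Region

variable (M) in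
/-- The factor by which the average queue length is multiplied to obtain the average delay
(Little's law). -/
noncomputable def delayScale : ℝ := 1 / (M.α * (M.A : ℝ))

theorem arrivalRate_pos : 0 < M.α * M.A :=
  mul_pos M.α_pos (Nat.cast_pos.2 M.one_le_A)

theorem delayScale_pos : 0 < M.delayScale :=
  one_div_pos.2 arrivalRate_pos

theorem arrivalRate_mul_delayScale : M.α * M.A * M.delayScale = 1 :=
  mul_one_div_cancel arrivalRate_pos.ne'

variable {γ : M.Policy} {q₀ : M.State} {z : ℝ × ℝ}

theorem Obtains.tendsto_weightedCost (h : M.Obtains γ q₀ z) (μ : ℝ) :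
    Tendsto (M.timeAverage γ q₀ fun q s => M.P s + μ * M.delayScale * (q : ℕ)) atTop
      (𝓝 (z.1 + μ * z.2)) := by
  refine (h.1.add (h.2.const_mul μ)).congr fun N => ?_
  rw [timeAverage_add γ q₀ (fun _ s => M.P s), timeAverage_const_mul, delayScale, mul_assoc]

theorem Obtains.tendsto_queue (h : M.Obtains γ q₀ z) :
    Tendsto (M.timeAverage γ q₀ fun q _ => ((q : ℕ) : ℝ)) atTop (𝓝 (M.α * M.A * z.2)) := by
  refine (h.2.const_mul (M.α * M.A)).congr fun N => ?_
  rw [← delayScale, ← mul_assoc, arrivalRate_mul_delayScale, one_mul]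

theorem Obtains.tendsto_residual (h : M.Obtains γ q₀ z) :
    Tendsto (M.timeAverage γ q₀ fun q s => (((q : ℕ) - (s : ℕ) : ℕ) : ℝ)) atTop
      (𝓝 (M.α * M.A * (z.2 - 1))) := by
  rw [mul_sub_one]
  refine (h.tendsto_queue.sub (tendsto_timeAverage_const_add_drift γ q₀ (M.α * M.A)
    fun n => (n : ℝ))).congr fun N => ?_
  rw [sub_eq_iff_eq_add, ← timeAverage_add]
  simp only [drift, nextMean_natCast]
  congr 1
  ext q s
  ring

/- With the potential `M.P`, the bound holds with equality when the residual level is `0`: then the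
power is `P q`, and the next state is `0` or `A`. -/
theorem exists_abs_power_sub_le (M : BufferModel) :
    ∃ K, 0 < K ∧ ∀ (q : M.State) (s : M.Action), M.Allowed q s →
      |M.P s - (M.α * M.P M.A + M.drift M.P q s)| ≤ K * (((q : ℕ) - (s : ℕ) : ℕ) : ℝ) := by
  let err : M.State × M.Action → ℝ := fun p =>
    |M.P p.2 - (M.α * M.P M.A + M.drift M.P p.1 p.2)|
  have herr : ∀ p, err p ≤ 1 + ∑ p, err p := fun p =>
    (Finset.single_le_sum (f := err) (fun p _ => abs_nonneg _) (Finset.mem_univ p)).trans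
      (by linarith)
  have hK : 0 < 1 + ∑ p, err p :=
    add_pos_of_pos_of_nonneg one_pos (Finset.sum_nonneg fun p _ => abs_nonneg _)
  refine ⟨1 + ∑ p, err p, hK, fun q s hs => ?_⟩
  rcases Nat.eq_zero_or_pos ((q : ℕ) - (s : ℕ)) with hx | hx
  · have hqs : (q : ℕ) = s := le_antisymm (Nat.sub_eq_zero_iff_le.1 hx) hs.1
    simp [drift, nextMean, hqs, M.P_zero]
  · exact (herr (q, s)).trans (le_mul_of_one_le_right hK.le (Nat.one_le_cast.2 hx))

theorem exists_abs_sub_le_of_mem_region (M : BufferModel) :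
    ∃ K, 0 < K ∧ ∀ q₀ : M.State, ∀ z ∈ M.region q₀,
      |z.1 - M.α * M.P M.A| ≤ K * (z.2 - 1) := by
  obtain ⟨K, hK, hc⟩ := exists_abs_power_sub_le M
  refine ⟨K * (M.α * M.A), mul_pos hK arrivalRate_pos, ?_⟩
  rintro q₀ z ⟨γ, h⟩
  rw [mul_assoc]
  exact abs_sub_le_of_tendsto_timeAverage hc h.1 h.tendsto_residual

theorem exists_isConeApex (M : BufferModel) : ∃ K, ∀ z : ℝ × ℝ, z.2 = 1 →
    ∀ q₀, z ∈ M.region q₀ → IsConeApex (M.region q₀) z K := by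
  obtain ⟨K, hK, hbound⟩ := exists_abs_sub_le_of_mem_region M
  refine ⟨K, fun z hz q₀ hmem => ⟨hmem, hK, fun w hw => ?_⟩⟩
  have hpower : z.1 = M.α * M.P M.A := by
    have := hbound q₀ z hmem
    rwa [hz, sub_self, mul_zero, abs_nonpos_iff, sub_eq_zero] at this
  rw [hpower, hz]
  exact hbound q₀ w hw

end Region

end BufferModel

/-! ### Long-run averages and the Poisson equation -/

namespace BufferModel

variable {M : BufferModel}

section Gain

variable {x y : ℕ → ℕ} {U : Set ℕ} {c f f' : ℕ → ℝ} {g g' C : ℝ} {a b n : ℕ}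

theorem nextMean_le (h : f n ≤ C) (hA : f (n + M.A) ≤ C) : M.nextMean f n ≤ C :=
  (nextMean_le_nextMean h hA).trans_eq (nextMean_const C n)

theorem le_nextMean (h : C ≤ f n) (hA : C ≤ f (n + M.A)) : C ≤ M.nextMean f n :=
  (nextMean_const C n).symm.trans_le (nextMean_le_nextMean h hA)

theorem nextMean_sub (f f' : ℕ → ℝ) (n : ℕ) :
    M.nextMean (fun n => f n - f' n) n = M.nextMean f n - M.nextMean f' n := by
  unfold nextMean
  ring

theorem eq_of_le_nextMean (h : f n ≤ C) (hA : f (n + M.A) ≤ C) (hC : C ≤ M.nextMean f n) :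
    f n = C ∧ f (n + M.A) = C := by
  have hα := M.α_pos
  have hα' := sub_pos.2 M.α_lt_one
  unfold nextMean at hC
  exact ⟨h.antisymm (by nlinarith), hA.antisymm (by nlinarith)⟩

theorem MonoLevels.mono (hx : M.MonoLevels x) (hab : a ≤ b) (hb : b ≤ M.Q) :
    x a ≤ x b := by
  induction b, hab using Nat.le_induction with
  | base => exact le_rfl
  | succ b _ ih => exact (ih (by omega)).trans (hx.le_succ b hb)

theorem MonoLevels.level_add_le (hx : M.MonoLevels x) (hab : a ≤ b) (hb : b ≤ M.Q) :
    x b + a ≤ x a + b := by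
  induction b, hab using Nat.le_induction with
  | base => exact le_rfl
  | succ b _ ih =>
    have := ih (by omega)
    have := hx.succ_le b hb
    omega

/-- `U` is a nonempty set of states that is closed under the transitions of the policy leaving
`x q` packets in state `q`. -/
structure ClosedClass (M : BufferModel) (x : ℕ → ℕ) (U : Set ℕ) : Prop where
  nonempty : U.Nonempty
  le : ∀ n ∈ U, n ≤ M.Q
  level_mem : ∀ n ∈ U, x n ∈ U
  level_add_mem : ∀ n ∈ U, x n + M.A ∈ U

theorem ClosedClass.finite (hU : M.ClosedClass x U) : U.Finite :=
  (Set.finite_Iic M.Q).subset hU.le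

theorem closedClass_Iic (hx : ∀ q ≤ M.Q, M.AdmLevel q (x q)) :
    M.ClosedClass x (Set.Iic M.Q) where
  nonempty := Set.nonempty_Iic
  le _ hn := hn
  level_mem n hn := (hx n hn).1.trans hn
  level_add_mem n hn := (hx n hn).2.2

theorem ClosedClass.eq_zero_of_add_eq_nextMean (hU : M.ClosedClass x U)
    (h : ∀ n ∈ U, g + f n = M.nextMean f (x n)) : g = 0 := by
  obtain ⟨m, hm, hmax⟩ := Set.exists_max_image U f hU.finite hU.nonempty
  obtain ⟨l, hl, hmin⟩ := Set.exists_min_image U f hU.finite hU.nonempty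
  have hle := nextMean_le (hmax _ (hU.level_mem m hm)) (hmax _ (hU.level_add_mem m hm))
  have hge := le_nextMean (hmin _ (hU.level_mem l hl)) (hmin _ (hU.level_add_mem l hl))
  linarith [h m hm, h l hl]

theorem closedClass_argmax (hx : ∀ q ≤ M.Q, M.AdmLevel q (x q))
    (hf : ∀ n ≤ M.Q, f n ≤ M.nextMean f (x n)) {m : ℕ} (hm : m ≤ M.Q)
    (hmax : ∀ n ≤ M.Q, f n ≤ f m) : M.ClosedClass x {n | n ≤ M.Q ∧ f n = f m} := by
  have hnext : ∀ n, n ≤ M.Q ∧ f n = f m → f (x n) = f m ∧ f (x n + M.A) = f m :=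
    fun n ⟨hn, hfn⟩ => eq_of_le_nextMean (hmax _ ((hx n hn).1.trans hn))
      (hmax _ (hx n hn).2.2) (hfn.symm.trans_le (hf n hn))
  exact ⟨⟨m, hm, rfl⟩, fun n hn => hn.1,
    fun n hn => ⟨(hx n hn.1).1.trans hn.1, (hnext n hn).1⟩,
    fun n hn => ⟨(hx n hn.1).2.2, (hnext n hn).2⟩⟩

theorem le_of_le_nextMean (hx : ∀ q ≤ M.Q, M.AdmLevel q (x q))
    (hb : ∀ U, M.ClosedClass x U → b ∈ U) (hf : ∀ n ≤ M.Q, f n ≤ M.nextMean f (x n))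
    (hn : n ≤ M.Q) : f n ≤ f b := by
  obtain ⟨m, hm, hmax⟩ := Set.exists_max_image (Set.Iic M.Q) f (Set.finite_Iic _)
    Set.nonempty_Iic
  rw [(hb _ (closedClass_argmax hx hf hm hmax)).2]
  exact hmax n hn

/- The greatest fixed point of `x` is such a state: the least state of `U` that is not below it is
a fixed point, and there is one because the greatest state `m` of `U` has `x m < m`. -/
theorem MonoLevels.exists_mem_closedClass (hx : M.MonoLevels x) :
    ∃ b, ∀ U, M.ClosedClass x U → b ∈ U := by
  obtain ⟨b, ⟨hbQ, hb⟩, hmax⟩ := Set.exists_max_image {n | n ≤ M.Q ∧ x n = n} id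
    ((Set.finite_Iic M.Q).subset fun n hn => hn.1)
    ⟨0, Nat.zero_le _, Nat.le_zero.1 (hx.adm 0 (Nat.zero_le _)).1⟩
  refine ⟨b, fun U hU => ?_⟩
  obtain ⟨m, hm, hmU⟩ := Set.exists_max_image U id hU.finite hU.nonempty
  have hA := M.one_le_A
  have hbm : b ≤ m := by
    by_contra! hlt
    have hslope := hx.level_add_le hlt.le hbQ
    have hup : x m + M.A ≤ m := hmU _ (hU.level_add_mem m hm)
    omega
  obtain ⟨k, ⟨hkU, hbk : b ≤ k⟩, hkmin⟩ := Set.exists_min_image (U ∩ Set.Ici b) id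
    (hU.finite.subset Set.inter_subset_left) ⟨m, hm, hbm⟩
  have hkQ := hU.le k hkU
  have hbxk : b ≤ x k := hb ▸ hx.mono hbk hkQ
  have hkx : k ≤ x k := hkmin (x k) ⟨hU.level_mem k hkU, hbxk⟩
  have hkb : k ≤ b := hmax k ⟨hkQ, (hx.adm k hkQ).1.antisymm hkx⟩
  rwa [hbk.antisymm hkb]

/-- `g` is the long-run average of the cost `c` (per state) under the policy leaving `x q` packets
in state `q`, as witnessed by a solution of the Poisson equation. -/
def IsGain (M : BufferModel) (x : ℕ → ℕ) (c : ℕ → ℝ) (g : ℝ) : Prop :=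
  ∃ f : ℕ → ℝ, ∀ n ≤ M.Q, c n = g + (f n - M.nextMean f (x n))

theorem ClosedClass.isGain_unique (hU : M.ClosedClass x U) (h : M.IsGain x c g)
    (h' : M.IsGain y c g') (hxy : ∀ n ∈ U, x n = y n) : g = g' := by
  obtain ⟨f, hf⟩ := h
  obtain ⟨f', hf'⟩ := h'
  refine sub_eq_zero.1 (hU.eq_zero_of_add_eq_nextMean (f := fun n => f n - f' n) fun n hn => ?_)
  rw [nextMean_sub]
  linarith [hf n (hU.le n hn), hxy n hn ▸ hf' n (hU.le n hn)]

theorem IsGain.add_const_mul {c' : ℕ → ℝ} (h : M.IsGain x c g) (h' : M.IsGain x c' g') (r : ℝ) :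
    M.IsGain x (fun n => c n + r * c' n) (g + r * g') := by
  obtain ⟨f, hf⟩ := h
  obtain ⟨f', hf'⟩ := h'
  refine ⟨fun n => f n + r * f' n, fun n hn => ?_⟩
  simp only [nextMean_add, nextMean_const_mul, hf n hn, hf' n hn]
  ring

/-- A function of the state as a function on `ℕ`; its values outside the state space are never
used. -/
def onNat (v : M.State → ℝ) (n : ℕ) : ℝ := v (Fin.ofNat (M.Q + 1) n)

theorem onNat_val (v : M.State → ℝ) (q : M.State) : M.onNat v q = v q := by
  simp [onNat]

/-- The linear map `v ↦ g + v - E v` of the Poisson equation, with the gain `g` normalized to be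
the value of `v` at `b`. -/
noncomputable def poissonMap (M : BufferModel) (x : ℕ → ℕ) (b : ℕ) :
    (M.State → ℝ) →ₗ[ℝ] (M.State → ℝ) where
  toFun v q := M.onNat v b + (M.onNat v q - M.nextMean (M.onNat v) (x q))
  map_add' v w := by
    ext q
    simp only [Pi.add_apply, onNat, nextMean]
    ring
  map_smul' r v := by
    ext q
    simp only [Pi.smul_apply, smul_eq_mul, onNat, nextMean, RingHom.id_apply]
    ring

theorem injective_poissonMap (hx : ∀ q ≤ M.Q, M.AdmLevel q (x q))
    (hb : ∀ U, M.ClosedClass x U → b ∈ U) : Function.Injective (M.poissonMap x b) := by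
  have hle : ∀ v, M.poissonMap x b v = 0 → ∀ q, v q ≤ 0 := by
    intro v hv q
    have heq : ∀ n ≤ M.Q, M.onNat v b + M.onNat v n = M.nextMean (M.onNat v) (x n) := by
      intro n hn
      have := congrFun hv ⟨n, Nat.lt_succ_of_le hn⟩
      change M.onNat v b + (M.onNat v n - M.nextMean (M.onNat v) (x n)) = 0 at this
      linarith
    have hzero : M.onNat v b = 0 := (closedClass_Iic hx).eq_zero_of_add_eq_nextMean heq
    rw [← onNat_val v q, ← hzero]
    exact le_of_le_nextMean hx hb (fun n hn => by linarith [heq n hn]) (by omega)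
  refine (injective_iff_map_eq_zero _).2 fun v hv => funext fun q => (hle v hv q).antisymm ?_
  exact neg_nonpos.1 (hle (-v) (by rw [map_neg, hv, neg_zero]) q)

theorem MonoLevels.exists_isGain (hx : M.MonoLevels x) (c : ℕ → ℝ) : ∃ g, M.IsGain x c g := by
  obtain ⟨b, hb⟩ := hx.exists_mem_closedClass
  obtain ⟨v, hv⟩ := LinearMap.injective_iff_surjective.1 (injective_poissonMap hx.adm hb)
    fun q => c q
  exact ⟨M.onNat v b, M.onNat v, fun n hn => (congrFun hv ⟨n, Nat.lt_succ_of_le hn⟩).symm⟩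

/-- The expected total cost over `k` timeslots of the policy leaving `x q` packets in state `q`, as
a function of the initial state. -/
noncomputable def totalCost (M : BufferModel) (x : ℕ → ℕ) (c : ℕ → ℝ) : ℕ → ℕ → ℝ
  | 0, _ => 0
  | k + 1, n => c n + M.nextMean (totalCost M x c k) (x n)

theorem MonoLevels.monotoneOn_totalCost (hx : M.MonoLevels x) (hc : MonotoneOn c (Set.Iic M.Q))
    (k : ℕ) : MonotoneOn (M.totalCost x c k) (Set.Iic M.Q) := by
  have hU := closedClass_Iic hx.adm
  induction k with
  | zero => exact fun _ _ _ _ _ => le_rfl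
  | succ k ih =>
    intro a ha b hb hab
    have hxab := hx.mono hab hb
    exact add_le_add (hc ha hb hab)
      (nextMean_le_nextMean (ih (hU.level_mem a ha) (hU.level_mem b hb) hxab)
        (ih (hU.level_add_mem a ha) (hU.level_add_mem b hb) (by omega)))

theorem MonoLevels.totalCost_le (hx : M.MonoLevels x) (hy : M.MonoLevels y)
    (hxy : ∀ n ≤ M.Q, x n ≤ y n) (hc : MonotoneOn c (Set.Iic M.Q)) (k : ℕ) :
    ∀ n ≤ M.Q, M.totalCost x c k n ≤ M.totalCost y c k n := by
  have hU := closedClass_Iic hx.adm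
  have hV := closedClass_Iic hy.adm
  induction k with
  | zero => exact fun _ _ => le_rfl
  | succ k ih =>
    intro n hn
    have hmono := hx.monotoneOn_totalCost hc k
    have hxyn := hxy n hn
    exact add_le_add_right (nextMean_le_nextMean
      ((hmono (hU.level_mem n hn) (hV.level_mem n hn) hxyn).trans (ih _ (hV.level_mem n hn)))
      ((hmono (hU.level_add_mem n hn) (hV.level_add_mem n hn) (by omega)).trans
        (ih _ (hV.level_add_mem n hn)))) _

theorem abs_totalCost_sub_le (hx : ∀ q ≤ M.Q, M.AdmLevel q (x q))
    (hf : ∀ n ≤ M.Q, c n = g + (f n - M.nextMean f (x n))) (hC : ∀ n ≤ M.Q, |f n| ≤ C)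
    (k : ℕ) : ∀ n ≤ M.Q, |M.totalCost x c k n - (k * g + f n)| ≤ C := by
  have hU := closedClass_Iic hx
  induction k with
  | zero => simpa [totalCost] using hC
  | succ k ih =>
    intro n hn
    set e : ℕ → ℝ := fun n => M.totalCost x c k n - (k * g + f n) with he
    have hstep : M.totalCost x c (k + 1) n - ((k + 1 : ℕ) * g + f n) = M.nextMean e (x n) := by
      rw [he, totalCost, hf n hn, nextMean_sub, nextMean_add, nextMean_const]
      push_cast
      ring
    obtain ⟨hl, hu⟩ := abs_le.1 (ih _ (hU.level_mem n hn))
    obtain ⟨hlA, huA⟩ := abs_le.1 (ih _ (hU.level_add_mem n hn))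
    rw [hstep]
    exact abs_le.2 ⟨le_nextMean hl hlA, nextMean_le hu huA⟩

theorem MonoLevels.isGain_mono (hx : M.MonoLevels x) (hy : M.MonoLevels y)
    (hxy : ∀ n ≤ M.Q, x n ≤ y n) (hc : MonotoneOn c (Set.Iic M.Q)) (h : M.IsGain x c g)
    (h' : M.IsGain y c g') : g ≤ g' := by
  obtain ⟨f, hf⟩ := h
  obtain ⟨f', hf'⟩ := h'
  obtain ⟨C, hC⟩ := exists_abs_le f M.Q
  obtain ⟨C', hC'⟩ := exists_abs_le f' M.Q
  have hbound : ∀ k : ℕ, k * (g - g') ≤ C + C' + (f' 0 - f 0) := by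
    intro k
    have hQ := Nat.zero_le M.Q
    linarith [hx.totalCost_le hy hxy hc k 0 hQ,
      (abs_le.1 (abs_totalCost_sub_le hx.adm hf hC k 0 hQ)).1,
      (abs_le.1 (abs_totalCost_sub_le hy.adm hf' hC' k 0 hQ)).2]
  by_contra! hlt
  obtain ⟨k, hk⟩ := exists_lt_nsmul (sub_pos.2 hlt) (C + C' + (f' 0 - f 0))
  rw [nsmul_eq_mul] at hk
  exact hk.not_ge (hbound k)

end Gain

end BufferModel

/-! ### The optimality equation -/

namespace BufferModel

variable {M : BufferModel}

section Optimality

theorem minCost_le_add {w w' : ℕ → ℝ} {δ : ℝ} {q : ℕ} (h : ∀ x, x + M.A ≤ M.Q → w x ≤ w' x + δ)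
    (hq : q ≤ M.Q) : M.minCost w q ≤ M.minCost w' q + δ := by
  have hadm := (loLevel_mem w' hq).1
  have hle := minCost_le (w := w) hadm hq
  unfold minCost levelCost at hle ⊢
  linarith [h _ hadm.2.2]

/-- The Bellman operator of the problem of minimizing the average of the transmission power plus `ν`
per waiting packet. -/
noncomputable def bellman (M : BufferModel) (ν : ℝ) (v : M.State → ℝ) (q : M.State) : ℝ :=
  ν * (q : ℕ) + M.minCost (M.nextMean (M.onNat v)) q

variable {ν β : ℝ} {v : M.State → ℝ}

theorem abs_onNat_le_norm (v : M.State → ℝ) (n : ℕ) : |M.onNat v n| ≤ ‖v‖ :=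
  norm_le_pi_norm v _

theorem onNat_bellman {n : ℕ} (hn : n ≤ M.Q) :
    M.onNat (M.bellman ν v) n = ν * n + M.minCost (M.nextMean (M.onNat v)) n := by
  simp [onNat, bellman, Nat.mod_eq_of_lt (Nat.lt_succ_of_le hn)]

theorem bellman_add_const (v : M.State → ℝ) (r : ℝ) :
    M.bellman ν (fun q => v q + r) = fun q => M.bellman ν v q + r := by
  have hmean : M.nextMean (M.onNat fun q => v q + r) = fun x => M.nextMean (M.onNat v) x + r :=
    funext fun x => (nextMean_add (M.onNat v) (fun _ => r) x).trans (by rw [nextMean_const])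
  funext q
  have hq : (q : ℕ) ≤ M.Q := by omega
  unfold bellman
  rw [hmean]
  refine le_antisymm ?_ ?_
  · linarith [minCost_le_add (M := M) (w := fun x => M.nextMean (M.onNat v) x + r)
      (fun _ _ => le_rfl) hq]
  · linarith [minCost_le_add (M := M) (w := M.nextMean (M.onNat v))
      (w' := fun x => M.nextMean (M.onNat v) x + r) (δ := -r) (fun _ _ => by linarith) hq]

theorem bellman_le_add_dist (ν : ℝ) (v v' : M.State → ℝ) (q : M.State) :
    M.bellman ν v q ≤ M.bellman ν v' q + dist v v' := by
  have hv : ∀ n, M.onNat v n ≤ M.onNat v' n + dist v v' := fun n => by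
    linarith [le_abs_self (M.onNat v n - M.onNat v' n),
      dist_le_pi_dist v v' (Fin.ofNat (M.Q + 1) n), Real.dist_eq (M.onNat v n) (M.onNat v' n),
      show dist (M.onNat v n) (M.onNat v' n) = dist (v (Fin.ofNat (M.Q + 1) n)) (v' _) from rfl]
  unfold bellman
  rw [add_assoc]
  refine add_le_add_right (minCost_le_add (fun x _ => ?_) (by omega)) _
  rw [← nextMean_const (M := M) (dist v v') x, ← nextMean_add]
  exact nextMean_le_nextMean (hv x) (hv _)

theorem lipschitzWith_bellman (ν : ℝ) : LipschitzWith 1 (M.bellman ν) := by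
  refine LipschitzWith.of_dist_le_mul fun v v' => ?_
  rw [NNReal.coe_one, one_mul, dist_pi_le_iff dist_nonneg]
  intro q
  have h := bellman_le_add_dist ν v v' q
  have h' := bellman_le_add_dist ν v' v q
  rw [dist_comm] at h'
  exact abs_sub_le_iff.2 ⟨by linarith, by linarith⟩

theorem convexUpTo_bellman (hv : ConvexUpTo M.Q (M.onNat v)) :
    ConvexUpTo M.Q (M.onNat (M.bellman ν v)) := by
  intro i hi
  have h := convexUpTo_minCost (convexUpTo_nextMean hv) i hi
  rw [onNat_bellman (by omega), onNat_bellman (by omega), onNat_bellman hi]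
  push_cast
  linarith

theorem isClosed_setOf_convexUpTo : IsClosed {v : M.State → ℝ | ConvexUpTo M.Q (M.onNat v)} := by
  simp only [ConvexUpTo, Set.ofPred_forall]
  refine isClosed_iInter fun i => isClosed_iInter fun _ => isClosed_le ?_ ?_ <;>
    exact (continuous_apply _).sub (continuous_apply _)

theorem exists_discounted_value (ν : ℝ) (h₀ : 0 ≤ β) (h₁ : β < 1) :
    ∃ v : M.State → ℝ, ConvexUpTo M.Q (M.onNat v) ∧ M.bellman ν (β • v) = v := by
  have hT : ContractingWith (1 * ‖β‖₊) fun v : M.State → ℝ => M.bellman ν (β • v) :=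
    ⟨by rwa [one_mul, ← NNReal.coe_lt_coe, coe_nnnorm, Real.norm_of_nonneg h₀],
      (lipschitzWith_bellman ν).comp (lipschitzWith_smul β)⟩
  refine ⟨hT.fixedPoint, isClosed_setOf_convexUpTo.mem_of_tendsto
    (hT.tendsto_iterate_fixedPoint 0) (Eventually.of_forall fun k => ?_), hT.fixedPoint_isFixedPt⟩
  induction k with
  | zero => exact fun _ _ => le_rfl
  | succ k ih =>
    rw [Function.iterate_succ_apply']
    exact convexUpTo_bellman (ConvexUpTo.const_mul ih h₀)

theorem one_sub_mul_norm_le (h₀ : 0 ≤ β) (hv : M.bellman ν (β • v) = v) :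
    (1 - β) * ‖v‖ ≤ ‖M.bellman ν 0‖ := by
  have h := (lipschitzWith_bellman (M := M) ν).dist_le_mul (β • v) 0
  rw [hv, NNReal.coe_one, one_mul, dist_zero_right, norm_smul, Real.norm_of_nonneg h₀,
    dist_eq_norm] at h
  linarith [norm_sub_norm_le v (M.bellman ν 0)]

/- Leaving `y` packets is possible in state `y` and, since `A ≤ S`, also in state `y + A`; this
compares `f` at the two states between which chance decides. -/
theorem sub_le_of_le_nextMean {f : ℕ → ℝ} {B : ℝ} {y : ℕ}
    (hle : ∀ q ≤ M.Q, ∀ y, M.AdmLevel q y → f q ≤ M.nextMean f y + M.α * (1 - M.α) * B)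
    (hy : y + M.A ≤ M.Q) :
    f y - f (y + M.A) ≤ (1 - M.α) * B ∧ f (y + M.A) - f y ≤ M.α * B := by
  have hAS := M.A_le_S
  have hstay := hle y (by omega) y ⟨le_rfl, by omega, hy⟩
  have hback := hle (y + M.A) hy y ⟨by omega, by omega, hy⟩
  unfold nextMean at hstay hback
  exact ⟨le_of_mul_le_mul_left (by linarith) M.α_pos,
    le_of_mul_le_mul_left (by linarith) (sub_pos.2 M.α_lt_one)⟩

theorem abs_sub_le_of_near_nextMean {f : ℕ → ℝ} {B : ℝ}
    (hle : ∀ q ≤ M.Q, ∀ y, M.AdmLevel q y → f q ≤ M.nextMean f y + M.α * (1 - M.α) * B)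
    (hge : ∀ q ≤ M.Q, ∃ y, M.AdmLevel q y ∧ M.nextMean f y ≤ f q + M.α * (1 - M.α) * B) :
    ∀ q ≤ M.Q, |f q - f 0| ≤ 2 * (M.Q + 1) * B := by
  have hα := M.α_pos
  have hAS := M.A_le_S
  have hAQ := M.A_le_Q
  have hA := M.one_le_A
  have hstay := fun y (hy : y + M.A ≤ M.Q) => (sub_le_of_le_nextMean hle hy).1
  have hback := fun y (hy : y + M.A ≤ M.Q) => (sub_le_of_le_nextMean hle hy).2
  have hB : 0 ≤ B := by linarith [hstay 0 (by omega), hback 0 (by omega)]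
  have hupper : ∀ q ≤ M.Q, ∀ y, M.AdmLevel q y → f q ≤ f y + B := fun q hq y hy => by
    have h := hle q hq y hy
    unfold nextMean at h
    linarith [mul_le_mul_of_nonneg_left (hback y hy.2.2) hα.le,
      mul_le_of_le_one_left hB M.α_lt_one.le]
  have hlower : ∀ q ≤ M.Q, ∃ y, M.AdmLevel q y ∧ f y ≤ f q + 2 * B := fun q hq => by
    obtain ⟨y, hy, h⟩ := hge q hq
    have hαB : M.α * (1 - M.α) * B ≤ B := mul_le_of_le_one_left hB (by nlinarith [M.α_lt_one])
    unfold nextMean at h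
    exact ⟨y, hy, by linarith [mul_le_mul_of_nonneg_left (hstay y hy.2.2) hα.le]⟩
  have hlevel : ∀ y, y + M.A ≤ M.Q → |f y - f 0| ≤ 2 * y * B := by
    intro y hy
    induction y with
    | zero => simp
    | succ y ih =>
      have hup := hupper (y + 1) (by omega) y ⟨by omega, by omega, by omega⟩
      have hdown := hupper (y + M.A) (by omega) (y + 1) ⟨by omega, by omega, hy⟩
      have ih := abs_le.1 (ih (by omega))
      push_cast
      exact abs_le.2 ⟨by linarith [hstay y (by omega), mul_nonneg hα.le hB], by linarith⟩
  intro q hq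
  obtain ⟨y, hy, hyq⟩ := hlower q hq
  have hyQ : (y : ℝ) * B ≤ M.Q * B :=
    mul_le_mul_of_nonneg_right (Nat.cast_le.2 (hy.1.trans hq)) hB
  have h := abs_le.1 (hlevel y hy.2.2)
  exact abs_le.2 ⟨by linarith [hupper q hq y hy], by linarith [hupper q hq y hy]⟩

theorem abs_discounted_nextMean_sub_le (h₀ : 0 ≤ β) (h₁ : β < 1) (hv : M.bellman ν (β • v) = v)
    (y : ℕ) : |M.nextMean (M.onNat (β • v)) y - M.nextMean (M.onNat v) y| ≤ ‖M.bellman ν 0‖ := by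
  have hnorm := abs_onNat_le_norm v
  have hmean : |M.nextMean (M.onNat v) y| ≤ ‖v‖ :=
    abs_le.2 ⟨le_nextMean (abs_le.1 (hnorm _)).1 (abs_le.1 (hnorm _)).1,
      nextMean_le (abs_le.1 (hnorm _)).2 (abs_le.1 (hnorm _)).2⟩
  calc |M.nextMean (M.onNat (β • v)) y - M.nextMean (M.onNat v) y|
      = |(1 - β) * M.nextMean (M.onNat v) y| := by
        rw [show M.onNat (β • v) = fun n => β * M.onNat v n from rfl, nextMean_const_mul,
          ← abs_neg, one_sub_mul, neg_sub]
    _ ≤ (1 - β) * ‖v‖ := by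
        rw [abs_mul, abs_of_pos (sub_pos.2 h₁)]
        exact mul_le_mul_of_nonneg_left hmean (sub_pos.2 h₁).le
    _ ≤ ‖M.bellman ν 0‖ := one_sub_mul_norm_le h₀ hv

theorem exists_forall_abs_discounted_value_sub_le (M : BufferModel) (ν : ℝ) :
    ∃ K, ∀ (β : ℝ) (v : M.State → ℝ), 0 ≤ β → β < 1 → M.bellman ν (β • v) = v →
      ∀ n ≤ M.Q, |M.onNat v n - M.onNat v 0| ≤ K := by
  obtain ⟨C, hC⟩ := exists_abs_le (fun n => ν * n) M.Q
  obtain ⟨C', hC'⟩ := exists_abs_le M.P M.Q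
  have hα : M.α * (1 - M.α) ≠ 0 := mul_ne_zero M.α_pos.ne' (sub_pos.2 M.α_lt_one).ne'
  refine ⟨2 * (M.Q + 1) * ((C + C' + ‖M.bellman ν 0‖) / (M.α * (1 - M.α))),
    fun β v h₀ h₁ hv => ?_⟩
  have heq : ∀ n ≤ M.Q, M.onNat v n = ν * n + M.minCost (M.nextMean (M.onNat (β • v))) n :=
    fun n hn => by rw [← onNat_bellman hn, hv]
  have hmean := abs_discounted_nextMean_sub_le h₀ h₁ hv
  generalize M.nextMean (M.onNat (β • v)) = w at heq hmean
  have hstep : ∀ n ≤ M.Q, ∀ y, |ν * n + M.levelCost w n y - M.nextMean (M.onNat v) y| ≤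
      C + C' + ‖M.bellman ν 0‖ := by
    intro n hn y
    rw [levelCost, ← add_assoc, add_sub_assoc]
    exact (abs_add_three _ _ _).trans
      (add_le_add_three (hC n hn) (hC' _ ((Nat.sub_le _ _).trans hn)) (hmean y))
  refine abs_sub_le_of_near_nextMean (fun n hn y hy => ?_)
    (fun n hn => ⟨_, (loLevel_mem w hn).1, ?_⟩)
  · rw [mul_div_cancel₀ _ hα, heq n hn]
    linarith [minCost_le (w := w) hy hn, (abs_le.1 (hstep n hn y)).2]
  · rw [mul_div_cancel₀ _ hα, heq n hn, minCost]
    linarith [(abs_le.1 (hstep n hn (M.loLevel w n))).1]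

theorem exists_bounded_relative_value (M : BufferModel) (ν : ℝ) :
    ∃ K, ∀ β : ℝ, 0 ≤ β → β < 1 → ∃ (h : M.State → ℝ) (g : ℝ), ‖(h, g)‖ ≤ K ∧
      ConvexUpTo M.Q (M.onNat h) ∧ M.bellman ν (β • h) = fun q => h q + g := by
  obtain ⟨K, hK⟩ := exists_forall_abs_discounted_value_sub_le M ν
  refine ⟨max K ‖M.bellman ν 0‖, fun β h₀ h₁ => ?_⟩
  obtain ⟨v, hconv, hv⟩ := exists_discounted_value (M := M) ν h₀ h₁
  have hK := hK β v h₀ h₁ hv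
  refine ⟨fun q => v q - M.onNat v 0, (1 - β) * M.onNat v 0, max_le_max ?_ ?_, fun i hi => ?_, ?_⟩
  · refine (pi_norm_le_iff_of_nonneg ((abs_nonneg _).trans (hK 0 M.Q.zero_le))).2 fun q => ?_
    simpa only [onNat_val, Real.norm_eq_abs] using hK q (by omega)
  · rw [norm_mul, Real.norm_of_nonneg (sub_pos.2 h₁).le]
    exact (mul_le_mul_of_nonneg_left (abs_onNat_le_norm v 0) (sub_pos.2 h₁).le).trans
      (one_sub_mul_norm_le h₀ hv)
  · simpa [onNat] using hconv i hi
  · have hshift : (β • fun q => v q - M.onNat v 0) =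
        fun q => (β • v) q + -(β * M.onNat v 0) := by
      funext q
      simp only [Pi.smul_apply, smul_eq_mul]
      ring
    rw [hshift, bellman_add_const, hv]
    funext q
    ring

theorem exists_optimality_solution (M : BufferModel) (ν : ℝ) : ∃ (h : M.State → ℝ) (g : ℝ),
    ConvexUpTo M.Q (M.onNat h) ∧ M.bellman ν h = fun q => h q + g := by
  obtain ⟨K, hK⟩ := exists_bounded_relative_value M ν
  have hβ₀ : ∀ k : ℕ, 0 ≤ 1 - 1 / ((k : ℝ) + 1) := fun k =>
    sub_nonneg.2 (div_le_one_of_le₀ (by simp) (by positivity))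
  have hβ₁ : ∀ k : ℕ, 1 - 1 / ((k : ℝ) + 1) < 1 := fun k => sub_lt_self _ (by positivity)
  choose h g hbounded hconv hbellman using fun k => hK _ (hβ₀ k) (hβ₁ k)
  have hβ : Tendsto (fun k : ℕ => 1 - 1 / ((k : ℝ) + 1)) atTop (𝓝 1) := by
    simpa using tendsto_one_div_add_atTop_nhds_zero_nat.const_sub (1 : ℝ)
  obtain ⟨p, -, ψ, hψ, hlim⟩ := tendsto_subseq_of_bounded
    (x := fun k => (h k, g k)) Metric.isBounded_closedBall
    fun k => mem_closedBall_zero_iff.2 (hbounded k)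
  have hh : Tendsto (h ∘ ψ) atTop (𝓝 p.1) := (continuous_fst.tendsto p).comp hlim
  have hg : Tendsto (g ∘ ψ) atTop (𝓝 p.2) := (continuous_snd.tendsto p).comp hlim
  refine ⟨p.1, p.2, isClosed_setOf_convexUpTo.mem_of_tendsto hh
    (Eventually.of_forall fun k => hconv (ψ k)), ?_⟩
  have hleft := ((lipschitzWith_bellman ν).continuous.tendsto _).comp
    ((hβ.comp hψ.tendsto_atTop).smul hh)
  rw [one_smul] at hleft
  refine tendsto_nhds_unique hleft (tendsto_pi_nhds.2 fun q => ?_)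
  refine ((tendsto_pi_nhds.1 hh q).add hg).congr fun k => ?_
  exact (congrFun (hbellman (ψ k)) q).symm

end Optimality

end BufferModel

/-! ### Policies with monotone levels -/

namespace BufferModel

variable {M : BufferModel} {x y : ℕ → ℕ} {z w : ℝ × ℝ} {μ g : ℝ} {h : ℕ → ℝ}

theorem Obtains.unique {γ : M.Policy} {q₀ : M.State} (hz : M.Obtains γ q₀ z)
    (hw : M.Obtains γ q₀ w) : z = w :=
  Prod.ext (tendsto_nhds_unique hz.1 hw.1) (tendsto_nhds_unique hz.2 hw.2)

theorem DetPolicy.finite (M : BufferModel) : Finite M.DetPolicy :=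
  .of_injective DetPolicy.act fun ⟨_, _⟩ ⟨_, _⟩ h => by cases h; rfl

/-- The deterministic policy leaving `x q` packets in state `q`. -/
def DetPolicy.ofLevels (x : ℕ → ℕ) (hx : ∀ q ≤ M.Q, M.AdmLevel q (x q)) : M.DetPolicy where
  act q := ⟨(q : ℕ) - x q, by
    have := (hx q (by omega)).2.1
    omega⟩
  allowed q := by
    obtain ⟨h₁, h₂, h₃⟩ := hx q (by omega)
    exact ⟨Nat.sub_le _ _, by simp only; omega⟩

theorem DetPolicy.differInOneState_ofLevels (hx : ∀ q ≤ M.Q, M.AdmLevel q (x q))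
    (hy : ∀ q ≤ M.Q, M.AdmLevel q (y q)) {r : ℕ} (hr : r ≤ M.Q) (hne : x r ≠ y r)
    (heq : ∀ n, n ≠ r → x n = y n) :
    (DetPolicy.ofLevels x hx).DifferInOneState (DetPolicy.ofLevels y hy) := by
  refine ⟨⟨r, Nat.lt_succ_of_le hr⟩, fun hact => ?_, fun q hq => ?_⟩
  · have hsub : r - x r = r - y r := congrArg Fin.val hact
    have := (hx r hr).1
    have := (hy r hr).1
    omega
  · simp only [ofLevels, heq q fun hqr => hq (Fin.ext hqr)]

/-- The policy leaving `x q` packets in state `q` has average power `z.1` and average delay `z.2`,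
expressed by the solvability of the Poisson equations for the two costs. -/
structure LevelPoint (M : BufferModel) (x : ℕ → ℕ) (z : ℝ × ℝ) : Prop where
  power : M.IsGain x (fun n => M.P (n - x n)) z.1
  delay : M.IsGain x (fun n => M.delayScale * n) z.2

theorem MonoLevels.exists_levelPoint (hx : M.MonoLevels x) : ∃ z, M.LevelPoint x z := by
  obtain ⟨p, hp⟩ := hx.exists_isGain fun n => M.P (n - x n)
  obtain ⟨d, hd⟩ := hx.exists_isGain fun n => M.delayScale * n
  exact ⟨(p, d), hp, hd⟩

theorem LevelPoint.snd_le (hz : M.LevelPoint x z) (hw : M.LevelPoint y w) (hx : M.MonoLevels x)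
    (hy : M.MonoLevels y) (hxy : ∀ n ≤ M.Q, x n ≤ y n) : z.2 ≤ w.2 :=
  hx.isGain_mono hy hxy
    ((Nat.mono_cast.const_mul M.delayScale_pos.le).monotoneOn _) hz.delay hw.delay

theorem LevelPoint.obtains (hz : M.LevelPoint x z) (hx : ∀ q ≤ M.Q, M.AdmLevel q (x q))
    (q₀ : M.State) : M.Obtains (DetPolicy.ofLevels x hx).toPolicy q₀ z := by
  obtain ⟨⟨f, hf⟩, ⟨f', hf'⟩⟩ := hz
  have hlevel : ∀ q : M.State, (q : ℕ) - ((q : ℕ) - x q) = x q := fun q =>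
    Nat.sub_sub_self (hx q (by omega)).1
  refine ⟨(DetPolicy.ofLevels x hx).tendsto_timeAverage (f := f) fun q => ?_,
    ((DetPolicy.ofLevels x hx).tendsto_timeAverage (c := fun q _ => M.delayScale * (q : ℕ))
      (f := f') fun q => ?_).congr fun N => timeAverage_const_mul _ _ _ _ _⟩
  · simp only [drift, DetPolicy.ofLevels, hlevel, hf q (by omega)]
  · simp only [drift, DetPolicy.ofLevels, hlevel, hf' q (by omega)]

/-- The delay-power points of the policies with monotone levels: the candidates for the vertices of
the tradeoff curve. -/
def monoPoints (M : BufferModel) : Set (ℝ × ℝ) := {z | ∃ x, M.MonoLevels x ∧ M.LevelPoint x z}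

theorem exists_detPolicy_of_mem_monoPoints (hz : z ∈ M.monoPoints) :
    ∃ F : M.DetPolicy, ∀ q₀, M.Obtains F.toPolicy q₀ z := by
  obtain ⟨x, hx, hz⟩ := hz
  exact ⟨_, hz.obtains hx.adm⟩

theorem monoPoints_subset_region (q₀ : M.State) : M.monoPoints ⊆ M.region q₀ := fun _ hz =>
  let ⟨F, hF⟩ := exists_detPolicy_of_mem_monoPoints hz
  ⟨F.toPolicy, hF q₀⟩

theorem finite_monoPoints (M : BufferModel) : M.monoPoints.Finite := by
  have := DetPolicy.finite M
  have hfin : (⋃ F : M.DetPolicy, {z | M.Obtains F.toPolicy 0 z}).Finite := by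
    refine Set.finite_iUnion fun F => Set.Subsingleton.finite fun z hz w hw => ?_
    exact Obtains.unique hz hw
  refine hfin.subset fun z hz => ?_
  obtain ⟨F, hF⟩ := exists_detPolicy_of_mem_monoPoints hz
  exact Set.mem_iUnion.2 ⟨F, hF 0⟩

/- Transmitting as much as possible never leaves more than the `A` packets just arrived. -/
theorem exists_mem_monoPoints_snd_eq_one (M : BufferModel) : ∃ z ∈ M.monoPoints, z.2 = 1 := by
  have hAS := M.A_le_S
  have hAQ := M.A_le_Q
  have hx : M.MonoLevels fun n => n - M.S :=
    ⟨fun q hq => ⟨by omega, by omega, by omega⟩, fun _ _ => by omega, fun _ _ => by omega⟩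
  obtain ⟨z, hz⟩ := hx.exists_levelPoint
  have hU : M.ClosedClass (fun n => n - M.S) {0, M.A} := by
    refine ⟨⟨0, .inl rfl⟩, ?_, ?_, ?_⟩ <;> rintro n (rfl | rfl)
    exacts [Nat.zero_le _, hAQ, .inl (by omega), .inl (by omega),
      .inr (show 0 - M.S + M.A = M.A by omega), .inr (show M.A - M.S + M.A = M.A by omega)]
  refine ⟨z, ⟨_, hx, hz⟩, hU.isGain_unique hz.delay (y := fun _ => 0)
    ⟨fun n => M.delayScale * n, fun n _ => ?_⟩ ?_⟩
  · rw [nextMean_const_mul, nextMean_natCast, Nat.cast_zero]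
    linarith [M.arrivalRate_mul_delayScale]
  · rintro n (rfl | rfl) <;> omega

theorem MonoLevels.max (hx : M.MonoLevels x) (hy : M.MonoLevels y) :
    M.MonoLevels fun n => max (x n) (y n) where
  adm q hq := by
    rcases max_choice (x q) (y q) with h | h <;> rw [h]
    exacts [hx.adm q hq, hy.adm q hq]
  le_succ q hq := max_le_max (hx.le_succ q hq) (hy.le_succ q hq)
  succ_le q hq := (max_le_max (hx.succ_le q hq) (hy.succ_le q hq)).trans_eq
    (max_add_add_right _ _ _)

theorem MonoLevels.min (hx : M.MonoLevels x) (hy : M.MonoLevels y) :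
    M.MonoLevels fun n => min (x n) (y n) where
  adm q hq := by
    rcases min_choice (x q) (y q) with h | h <;> rw [h]
    exacts [hx.adm q hq, hy.adm q hq]
  le_succ q hq := min_le_min (hx.le_succ q hq) (hy.le_succ q hq)
  succ_le q hq := (min_le_min (hx.succ_le q hq) (hy.succ_le q hq)).trans_eq
    (min_add_add_right _ _ _)

/-- The levels `x` with the level of state `r` raised by one. -/
def raise (x : ℕ → ℕ) (r : ℕ) : ℕ → ℕ := Function.update x r (x r + 1)

theorem raise_apply (x : ℕ → ℕ) (r n : ℕ) : raise x r n = if n = r then x r + 1 else x n :=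
  Function.update_apply ..

theorem MonoLevels.raise {r : ℕ} (hx : M.MonoLevels x) (hadm : M.AdmLevel r (x r + 1))
    (hr : r ≠ 0) (hpred : x (r - 1) = x r) (hsucc : r + 1 ≤ M.Q → x (r + 1) ≠ x r) :
    M.MonoLevels (raise x r) where
  adm q hq := by
    rw [raise_apply]
    split_ifs with h
    exacts [h ▸ hadm, hx.adm q hq]
  le_succ q hq := by
    grind [hx.le_succ q hq, raise_apply]
  succ_le q hq := by
    grind [hx.succ_le q hq, raise_apply]

/- Raise `x` at the greatest state below `y` whose predecessor has the same level under `x`. If the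
next state had that level too, it would be a greater such state, because `y` is nondecreasing. -/
theorem MonoLevels.exists_raise (hx : M.MonoLevels x) (hy : M.MonoLevels y)
    (hne : ∃ n ≤ M.Q, x n < y n) :
    ∃ r ≤ M.Q, x r < y r ∧ M.MonoLevels (BufferModel.raise x r) := by
  classical
  obtain ⟨haQ, halt⟩ := Nat.find_spec hne
  set a := Nat.find hne
  have hy0 := (hy.adm 0 (Nat.zero_le _)).1
  have ha0 : a ≠ 0 := fun h => by
    rw [h] at halt
    omega
  have hpred : x (a - 1) = x a := by
    have hmin := Nat.find_min hne (m := a - 1) (by omega)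
    have hxa := hx.le_succ (a - 1) (by omega)
    have hya := hy.succ_le (a - 1) (by omega)
    rw [Nat.sub_add_cancel (by omega)] at hxa hya
    omega
  obtain ⟨r, ⟨hrQ, hr, hr0, hrpred⟩, hmax⟩ := Set.exists_max_image
    {n | n ≤ M.Q ∧ x n < y n ∧ n ≠ 0 ∧ x (n - 1) = x n} id
    ((Set.finite_Iic M.Q).subset fun n hn => hn.1) ⟨a, haQ, halt, ha0, hpred⟩
  obtain ⟨hxr, hxr', -⟩ := hx.adm r hrQ
  obtain ⟨hyr, -, hyr'⟩ := hy.adm r hrQ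
  refine ⟨r, hrQ, hr, hx.raise ⟨by omega, by omega, by omega⟩ hr0 hrpred fun hrQ' heq => ?_⟩
  have hlt : x (r + 1) < y (r + 1) := heq ▸ hr.trans_le (hy.le_succ r hrQ')
  exact (Nat.lt_succ_self r).not_ge (hmax (r + 1) ⟨hrQ', hlt, r.succ_ne_zero, heq.symm⟩)

/-- `g` and the convex bias `h` solve the optimality equation for power plus `μ` times delay. -/
structure OptimalitySolution (M : BufferModel) (μ g : ℝ) (h : ℕ → ℝ) : Prop where
  convex : ConvexUpTo M.Q h
  eq : ∀ n ≤ M.Q, h n + g = μ * (M.delayScale * n) + M.minCost (M.nextMean h) n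

theorem exists_optimalitySolution (M : BufferModel) (μ : ℝ) :
    ∃ g h, M.OptimalitySolution μ g h := by
  obtain ⟨v, g, hconv, heq⟩ := M.exists_optimality_solution (μ * M.delayScale)
  refine ⟨g, M.onNat v, hconv, fun n hn => ?_⟩
  rw [← mul_assoc, ← onNat_bellman hn, heq, onNat, onNat]

/-- Monotone levels attaining the minimum in the optimality equation with bias `h`. -/
structure OptimalLevels (M : BufferModel) (h : ℕ → ℝ) (x : ℕ → ℕ) : Prop extends
    M.MonoLevels x where
  opt : ∀ n ≤ M.Q, x n ∈ M.optLevels (M.nextMean h) n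

namespace OptimalitySolution

theorem le_of_mem_region (H : M.OptimalitySolution μ g h) {q₀ : M.State}
    (hz : z ∈ M.region q₀) : g ≤ z.1 + μ * z.2 := by
  obtain ⟨γ, hγ⟩ := hz
  refine le_of_tendsto_timeAverage (f := h) (fun q s hs => ?_) (hγ.tendsto_weightedCost μ)
  have hmin := minCost_le (w := M.nextMean h) hs.admLevel (by omega)
  rw [levelCost, Nat.sub_sub_self hs.1] at hmin
  rw [drift]
  linarith [H.eq q (by omega)]

theorem optimalLevels_loLevel (H : M.OptimalitySolution μ g h) :
    M.OptimalLevels h (M.loLevel (M.nextMean h)) :=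
  ⟨monoLevels_loLevel (convexUpTo_nextMean H.convex), fun _ hn => loLevel_mem _ hn⟩

theorem optimalLevels_hiLevel (H : M.OptimalitySolution μ g h) :
    M.OptimalLevels h (M.hiLevel (M.nextMean h)) :=
  ⟨monoLevels_hiLevel (convexUpTo_nextMean H.convex), fun _ hn => hiLevel_mem _ hn⟩

theorem eq_of_levelPoint (H : M.OptimalitySolution μ g h) (hx : M.OptimalLevels h x)
    (hz : M.LevelPoint x z) : z.1 + μ * z.2 = g := by
  refine (closedClass_Iic hx.adm).isGain_unique (hz.power.add_const_mul hz.delay μ)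
    ⟨h, fun n hn => ?_⟩ fun _ _ => rfl
  have hcost : M.P (n - x n) + M.nextMean h (x n) = M.minCost (M.nextMean h) n :=
    (minCost_eq (hx.opt n hn) hn).symm
  linarith [H.eq n hn]

theorem onFace (H : M.OptimalitySolution μ g h) (hx : M.OptimalLevels h x)
    (hz : M.LevelPoint x z) : OnFace M.monoPoints μ z :=
  ⟨⟨x, hx.toMonoLevels, hz⟩, fun _ hw => (H.eq_of_levelPoint hx hz).trans_le
    (H.le_of_mem_region (monoPoints_subset_region 0 hw))⟩

theorem eq_of_onFace (H : M.OptimalitySolution μ g h) (hz : OnFace M.monoPoints μ z) :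
    z.1 + μ * z.2 = g := by
  obtain ⟨w, hw⟩ := H.optimalLevels_loLevel.exists_levelPoint
  have hw' := H.optimalLevels_loLevel
  exact ((hz.le w ⟨_, hw'.toMonoLevels, hw⟩).trans_eq (H.eq_of_levelPoint hw' hw)).antisymm
    (H.le_of_mem_region (monoPoints_subset_region 0 hz.mem))

end OptimalitySolution

theorem onFace_region (hz : OnFace M.monoPoints μ z) (q₀ : M.State) :
    OnFace (M.region q₀) μ z := by
  obtain ⟨g, h, H⟩ := M.exists_optimalitySolution μ
  exact ⟨monoPoints_subset_region q₀ hz.mem, fun w hw =>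
    (H.eq_of_onFace hz).trans_le (H.le_of_mem_region hw)⟩

/-- A step along the tradeoff curve: the delay increases, the two points lie on a common face of
nonnegative weight, and they are obtained by deterministic policies that differ in one state. -/
structure CurveStep (M : BufferModel) (z z' : ℝ × ℝ) : Prop where
  snd_lt : z.2 < z'.2
  face : ∃ μ, 0 ≤ μ ∧ OnFace M.monoPoints μ z ∧ OnFace M.monoPoints μ z'
  policies : ∃ F F' : M.DetPolicy, (∀ q₀, M.Obtains F.toPolicy q₀ z) ∧
    (∀ q₀, M.Obtains F'.toPolicy q₀ z') ∧ F.DifferInOneState F'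

namespace OptimalitySolution

theorem reflTransGen_raise (H : M.OptimalitySolution μ g h) (hμ : 0 ≤ μ)
    (hx : M.OptimalLevels h x) {r : ℕ} (hr : r ≤ M.Q) (hx' : M.OptimalLevels h (raise x r))
    (hz : M.LevelPoint x z) (hw : M.LevelPoint (raise x r) w) :
    Relation.ReflTransGen M.CurveStep z w := by
  have hzμ := H.onFace hx hz
  have hwμ := H.onFace hx' hw
  have hle : z.2 ≤ w.2 := hz.snd_le hw hx.toMonoLevels hx'.toMonoLevels fun n _ => by
    rw [raise_apply]
    split_ifs with h <;> [rw [h]; skip] <;> omega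
  rcases hle.eq_or_lt with heq | hlt
  · rw [hzμ.eq_of_snd_eq hwμ heq]
  · refine .single ⟨hlt, ⟨μ, hμ, hzμ, hwμ⟩, _, _, hz.obtains hx.adm, hw.obtains hx'.adm,
      DetPolicy.differInOneState_ofLevels _ _ hr ?_ fun n hn => ?_⟩
    · simp [raise_apply]
    · rw [raise_apply, if_neg hn]

theorem reflTransGen {x : ℕ → ℕ} {z : ℝ × ℝ} (H : M.OptimalitySolution μ g h) (hμ : 0 ≤ μ)
    (hx : M.OptimalLevels h x) (hy : M.OptimalLevels h y) (hxy : ∀ n ≤ M.Q, x n ≤ y n)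
    (hz : M.LevelPoint x z) (hw : M.LevelPoint y w) : Relation.ReflTransGen M.CurveStep z w := by
  by_cases hne : ∃ n ≤ M.Q, x n < y n
  · obtain ⟨r, hr, hlt, hmono⟩ := hx.exists_raise hy.toMonoLevels hne
    have hbetween : ∀ n ≤ M.Q, x n ≤ raise x r n ∧ raise x r n ≤ y n := fun n hn => by
      grind [raise_apply]
    have hx' : M.OptimalLevels h (raise x r) := ⟨hmono, fun n hn => mem_optLevels_of_between
      (convexUpTo_nextMean H.convex) (hx.opt n hn) (hy.opt n hn) (hbetween n hn).1
      (hbetween n hn).2⟩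
    obtain ⟨v, hv⟩ := hmono.exists_levelPoint
    exact (H.reflTransGen_raise hμ hx hr hx' hz hv).trans
      (H.reflTransGen hμ hx' hy (fun n hn => (hbetween n hn).2) hv hw)
  · have heq : ∀ n ≤ M.Q, x n = y n := fun n hn =>
      (hxy n hn).antisymm (not_lt.1 fun hlt => hne ⟨n, hn, hlt⟩)
    rw [(H.onFace hx hz).eq_of_snd_eq (H.onFace hy hw)
      ((closedClass_Iic hx.adm).isGain_unique hz.delay hw.delay heq)]
termination_by ∑ n ∈ Finset.range (M.Q + 1), (y n - x n)
decreasing_by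
  refine Finset.sum_lt_sum (fun n _ => ?_) ⟨r, Finset.mem_range.2 (by omega), ?_⟩ <;>
  grind [raise_apply]

theorem exists_closedClass_optLevels (H : M.OptimalitySolution μ g h) (hx : M.MonoLevels x)
    (hz : M.LevelPoint x z) (hface : z.1 + μ * z.2 = g) :
    ∃ U, M.ClosedClass x U ∧ ∀ n ∈ U, x n ∈ M.optLevels (M.nextMean h) n := by
  obtain ⟨f, hf⟩ := hz.power.add_const_mul hz.delay μ
  rw [hface] at hf
  have hle : ∀ n ≤ M.Q, h n - f n ≤ M.nextMean (fun n => h n - f n) (x n) := fun n hn => by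
    have hmin : _ ≤ M.P (n - x n) + M.nextMean h (x n) := minCost_le (hx.adm n hn) hn
    rw [nextMean_sub]
    linarith [hf n hn, H.eq n hn]
  obtain ⟨m, hm, hmax⟩ := Set.exists_max_image (Set.Iic M.Q) (fun n => h n - f n)
    (Set.finite_Iic _) Set.nonempty_Iic
  have hU := closedClass_argmax hx.adm hle hm hmax
  refine ⟨_, hU, fun n hn => ⟨hx.adm n hn.1, fun y hy => ?_⟩⟩
  have hnext := nextMean_le (f := fun n => h n - f n) (hU.level_mem n hn).2.le
    (hU.level_add_mem n hn).2.le
  rw [nextMean_sub, ← hn.2] at hnext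
  have hmin := minCost_le (w := M.nextMean h) hy hn.1
  unfold levelCost at hmin ⊢
  linarith [hf n hn.1, H.eq n hn.1]

theorem snd_mem_Icc (H : M.OptimalitySolution μ g h) {lo hi : ℝ × ℝ}
    (hlo : M.LevelPoint (M.loLevel (M.nextMean h)) lo)
    (hhi : M.LevelPoint (M.hiLevel (M.nextMean h)) hi) (hz : OnFace M.monoPoints μ z) :
    z.2 ∈ Set.Icc lo.2 hi.2 := by
  obtain ⟨x, hx, hxz⟩ := hz.mem
  obtain ⟨U, hU, hopt⟩ := H.exists_closedClass_optLevels hx hxz (H.eq_of_onFace hz)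
  have hl := H.optimalLevels_loLevel.toMonoLevels
  have hh := H.optimalLevels_hiLevel.toMonoLevels
  have hy := hl.max (hh.min hx)
  obtain ⟨w, hw⟩ := hy.exists_levelPoint
  have hzw : z.2 = w.2 := hU.isGain_unique hxz.delay hw.delay fun n hn => by
    rw [min_eq_right (le_hiLevel (hopt n hn)), max_eq_right (loLevel_le (hopt n hn))]
  rw [hzw]
  exact ⟨hlo.snd_le hw hl hy fun n _ => le_max_left _ _, hw.snd_le hhi hy hh fun n hn =>
    max_le (loLevel_le (hiLevel_mem _ hn)) (min_le_left _ _)⟩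

end OptimalitySolution

theorem exists_face_path (M : BufferModel) (hμ : 0 ≤ μ) :
    ∃ lo hi, OnFace M.monoPoints μ lo ∧ OnFace M.monoPoints μ hi ∧
      Relation.ReflTransGen M.CurveStep lo hi ∧
      ∀ z, OnFace M.monoPoints μ z → z.2 ∈ Set.Icc lo.2 hi.2 := by
  obtain ⟨g, h, H⟩ := M.exists_optimalitySolution μ
  have hl := H.optimalLevels_loLevel
  have hh := H.optimalLevels_hiLevel
  obtain ⟨lo, hlo⟩ := hl.exists_levelPoint
  obtain ⟨hi, hhi⟩ := hh.exists_levelPoint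
  exact ⟨lo, hi, H.onFace hl hlo, H.onFace hh hhi, H.reflTransGen hμ hl hh
    (fun n hn => loLevel_le (hiLevel_mem _ hn)) hlo hhi, fun z hz => H.snd_mem_Icc hlo hhi hz⟩

end BufferModel

/-! ### The vertices of the tradeoff curve -/

namespace BufferModel

variable {M : BufferModel} {a z : ℝ × ℝ} {μ ν K : ℝ}

theorem exists_next_vertex (M : BufferModel) (hz : IsLastOnFace M.monoPoints μ z) :
    (∃ ν < 0, OnFace M.monoPoints ν z) ∨ ∃ z', z.2 < z'.2 ∧
      Relation.ReflTransGen M.CurveStep z z' ∧ ∃ ν, IsLastOnFace M.monoPoints ν z' := by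
  rcases hz.exists_pivot M.finite_monoPoints with hall | ⟨ν, hνμ, hzν, v, hzv, hvν⟩
  · exact .inl ⟨min 0 μ - 1, by linarith [min_le_left 0 μ], hall _ (by linarith [min_le_right 0 μ])⟩
  rcases lt_or_ge ν 0 with hν | hν
  · exact .inl ⟨ν, hν, hzν⟩
  obtain ⟨lo, hi, hlo, hhi, hpath, hface⟩ := M.exists_face_path hν
  have hzlo : lo = z :=
    hlo.eq_of_snd_eq hzν ((hface z hzν).1.antisymm (hz.toOnFace.snd_le hlo hνμ))
  exact .inr ⟨hi, hzv.trans_le (hface v hvν).2, hzlo ▸ hpath, ν, hhi, fun w hw => (hface w hw).2⟩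

theorem exists_last_vertex (M : BufferModel) (ha : IsLastOnFace M.monoPoints μ a) :
    ∃ z, Relation.ReflTransGen M.CurveStep a z ∧ ∃ ν < 0, OnFace M.monoPoints ν z := by
  obtain ⟨z, ⟨-, hpath, ν, hz⟩, hmax⟩ := Set.exists_max_image {z | z ∈ M.monoPoints ∧
    Relation.ReflTransGen M.CurveStep a z ∧ ∃ ν, IsLastOnFace M.monoPoints ν z} Prod.snd
    (M.finite_monoPoints.subset (Set.sep_subset _ _)) ⟨a, ha.mem, .refl, μ, ha⟩
  refine ⟨z, hpath, (M.exists_next_vertex hz).resolve_right ?_⟩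
  rintro ⟨z', hlt, hstep, ν', hz'⟩
  exact hlt.not_ge (hmax z' ⟨hz'.mem, hpath.trans hstep, ν', hz'⟩)

theorem isLastOnFace_of_isConeApex {q₀ : M.State} (ha : IsConeApex (M.region q₀) a K)
    (ham : a ∈ M.monoPoints) (hμ : K < μ) : IsLastOnFace M.monoPoints μ a :=
  ⟨(ha.onFace hμ.le).anti (monoPoints_subset_region q₀) ham, fun _ hw =>
    (ha.eq_of_onFace hμ (onFace_region hw q₀)).le.2⟩

theorem exists_curveStep_chain (M : BufferModel) :
    ∃ (n : ℕ) (z : Fin (n + 1) → ℝ × ℝ), (∀ q₀, IsFrontChain (M.region q₀) z) ∧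
      (∀ i, z i ∈ M.monoPoints) ∧ ∀ i : Fin n, M.CurveStep (z i.castSucc) (z i.succ) := by
  obtain ⟨a, ha, ha1⟩ := M.exists_mem_monoPoints_snd_eq_one
  obtain ⟨K, hK⟩ := M.exists_isConeApex
  have hapex := fun q₀ => hK a ha1 q₀ (monoPoints_subset_region q₀ ha)
  obtain ⟨b, hpath, ν, hν, hb⟩ :=
    M.exists_last_vertex (isLastOnFace_of_isConeApex (hapex 0) ha (lt_add_one K))
  obtain ⟨n, z, rfl, rfl, hstep⟩ := exists_fin_sequence_of_reflTransGen hpath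
  refine ⟨n, z, fun q₀ => ?_, Fin.cases ha fun i => ?_, hstep⟩
  · refine ⟨convex_region q₀, ⟨K, hapex q₀⟩, fun i => (hstep i).snd_lt, fun i => ?_, fun w hw =>
      (hapex q₀).snd_le_of_onFace_neg (convex_region q₀) (onFace_region hb q₀) hν hw⟩
    obtain ⟨μ, hμ, hi, hi'⟩ := (hstep i).face
    exact ⟨μ, hμ, onFace_region hi q₀, onFace_region hi' q₀⟩
  · obtain ⟨μ, -, -, hi⟩ := (hstep i).face
    exact hi.mem

theorem tradeoffCurve_eq_weakParetoFront (M : BufferModel) (q₀ : M.State) :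
    M.tradeoffCurve q₀ = weakParetoFront (M.region q₀) :=
  rfl

end BufferModel

theorem corollary3 (M : BufferModel) :
    (∀ q₀ : M.State, DecreasingCurve (M.tradeoffCurve q₀) ∧ ConvexCurve (M.tradeoffCurve q₀)) ∧
    ∃ (n : ℕ) (z : Fin (n + 1) → ℝ × ℝ),
      -- piecewise linear, with the vertices listed in order along the curve
      (∀ q₀ : M.State, M.tradeoffCurve q₀ = polygonalChain z) ∧
      StrictMono (fun i => (z i).2) ∧ Antitone (fun i => (z i).1) ∧
      -- the list contains every corner of the curve
      (∀ (q₀ : M.State) (v : ℝ × ℝ), IsCurveCorner (M.tradeoffCurve q₀) v → ∃ i, z i = v) ∧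
      -- the vertices are obtained by deterministic policies
      (∀ i, ∃ F : M.DetPolicy, ∀ q₀ : M.State, M.Obtains F.toPolicy q₀ (z i)) ∧
      -- neighbouring vertices are obtained by policies that differ in exactly one state
      (∀ i : Fin n, ∃ F F' : M.DetPolicy,
        (∀ q₀ : M.State, M.Obtains F.toPolicy q₀ (z i.castSucc)) ∧
        (∀ q₀ : M.State, M.Obtains F'.toPolicy q₀ (z i.succ)) ∧
        F.DifferInOneState F') := by
  obtain ⟨n, z, hz, hmem, hstep⟩ := M.exists_curveStep_chain
  simp only [BufferModel.tradeoffCurve_eq_weakParetoFront]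
  exact ⟨fun q₀ => ⟨(hz q₀).decreasingCurve, (hz q₀).convexCurve⟩, n, z,
    fun q₀ => (hz q₀).weakParetoFront_eq, (hz 0).strictMono_snd, (hz 0).antitone_fst,
    fun q₀ _ hv => (hz q₀).exists_eq_of_isCurveCorner hv,
    fun i => BufferModel.exists_detPolicy_of_mem_monoPoints (hmem i), fun i => (hstep i).policies⟩
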